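/- A \emph{category with fibrations} is a category with a terminal object and a class of maps, called fibrations, such that pullbacks of fibrations along arbitrary maps exist and are fibrations. An object is \emph{fibrant} if its map to the terminal object is a fibration. For a category with fibrations $\mathcal{C}$ and an object $X$ of $\mathcal{C}$, let $\mathcal{C}_!(X)$ be the contextual category of iterated context extensions of $X$ given by the local universes construction: a type in a context with underlying object $Y$ is a fibration $p_A : E_A \to V_A$ together with a map $r_A : Y \to V_A$, a term of this type is a map $t : Y \to E_A$ with $p_A t = r_A$, the extended context is $Y \times_{V_A} E_A$, and substitution is precomposition. A map $X' \to X$ induces a reindexing contextual functor $\mathcal{C}_!(X) \to \mathcal{C}_!(X')$, strictly functorially, and $\mathcal{C}_! := \mathcal{C}_!(1)$. For a functor $F : \mathcal{B} \to \mathcal{C}$ between categories with fibrations, $F^*(\mathcal{C}_!)$ is the contextually indexed contextual category $\Gamma \mapsto \mathcal{C}_!(F(\Gamma))$, where $\Gamma$ ranges over the contexts of $\mathcal{B}_!$ (regarded as objects of $\mathcal{B}$). A contextually indexed contextual category \emph{has $\Pi$-types} if each of its fibres has $\Pi$-types with abstraction and application satisfying the $\beta$- and $\eta$-rules, strictly stable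 under substitution and under reindexing. It is \emph{Cartesian closed} if it has $\Pi$-types in the empty indexed context: for each base context $\Gamma$, each closed indexed type $A$ over $\Gamma$ and each indexed type $B$ depending on $x : A$, there is a closed indexed type $\Pi_{x : A} B$ over $\Gamma$, with abstraction and application for terms in an arbitrary indexed context $\Delta$, satisfying the $\beta$- and $\eta$-rules and strictly stable under substitution in $\Delta$ and under reindexing. Let $F : \mathcal{B} \to \mathcal{C}$ be a functor between categories with fibrations, where $\mathcal{C}$ has binary products. Suppose that, for every fibration $f : A \to B$ in $\mathcal{C}$, the pullback functor $f^* : \mathcal{C}/B \to \mathcal{C}/A$ has a right adjoint $\Pi_f : \mathcal{C}/A \to \mathcal{C}/B$. Then: \begin{enumerate} \item If, for every fibration $f : A \to B$ in $\mathcal{C}$, $\Pi_f$ maps fibrations over $A$ to fibrations over $B$, then $F^*(\mathcal{C}_!)$ has $\Pi$-types. \item Suppose that the fibrations of $\mathcal{B}$ contain the identities and are closed under composition. Suppose that there is a full subcategory $\mathcal{C}'$ of $\mathcal{C}$ such that $\Pi_f$ maps fibrations over $A$ to fibrations over $B$ for every fibration $f : A \to B$ with $B$ in $\mathcal{C}'$.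 Suppose moreover that for every object $X$ of $\mathcal{C}$ there is a map $\varepsilon_X : X' \to X$ with $X'$ in $\mathcal{C}'$ such that, for every fibrant object $\Gamma$ of $\mathcal{B}$, every map $h : F(\Gamma) \to X$ has a chosen factorization $h = \varepsilon_X \circ \bar h$ which is natural in $\Gamma$, that is $\overline{h \circ F(s)} = \bar h \circ F(s)$ for all maps $s : \Gamma' \to \Gamma$ between fibrant objects of $\mathcal{B}$. Then $F^*(\mathcal{C}_!)$ has $\Pi$-types in the empty indexed context, that is, it is Cartesian closed. \end{enumerate} -/

import Mathlib

open CategoryTheory CategoryTheory.Limits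

universe w w₁ w₂ v v₁ v₂ v₃ u u₁ u₂ u₃

namespace IndexedTT

/-! ## Categories with strictly substitutable types and terms -/

/-- A category with families on a category `D`: presheaves of types and terms, a map `tp` sending a
term to its type (so a term of type `A` is a `t` with `tp t = A`), and, for each type `A` over `X`, a context extension `ext A` with a projection to
`X` and a generic term `var A`, such that maps `Y ⟶ ext A` are the same as pairs of a map
`f : Y ⟶ X` and a term of type `A[f]`. In particular, terms of type `A` over `X` are the same as
sections of `proj A`, and the canonical pullback squares with their strict functoriality follow. -/
structure CwF (D : Type u) [Category.{v} D] where
  Ty : D → Type w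
  Tm : D → Type w
  tp : ∀ {X : D}, Tm X → Ty X
  tySub : ∀ {X Y : D}, (Y ⟶ X) → Ty X → Ty Y
  tmSub : ∀ {X Y : D}, (Y ⟶ X) → Tm X → Tm Y
  tySub_id : ∀ {X : D} (A : Ty X), tySub (𝟙 X) A = A
  tySub_comp : ∀ {X Y Z : D} (g : Z ⟶ Y) (f : Y ⟶ X) (A : Ty X),
    tySub (g ≫ f) A = tySub g (tySub f A)
  tmSub_id : ∀ {X : D} (t : Tm X), tmSub (𝟙 X) t = t
  tmSub_comp : ∀ {X Y Z : D} (g : Z ⟶ Y) (f : Y ⟶ X) (t : Tm X),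
    tmSub (g ≫ f) t = tmSub g (tmSub f t)
  tp_tmSub : ∀ {X Y : D} (f : Y ⟶ X) (t : Tm X), tp (tmSub f t) = tySub f (tp t)
  ext : ∀ {X : D}, Ty X → D
  proj : ∀ {X : D} (A : Ty X), ext A ⟶ X
  var : ∀ {X : D} (A : Ty X), Tm (ext A)
  tp_var : ∀ {X : D} (A : Ty X), tp (var A) = tySub (proj A) A
  pair : ∀ {X Y : D} (f : Y ⟶ X) (A : Ty X) (t : Tm Y), tp t = tySub f A → (Y ⟶ ext A)
  pair_proj : ∀ {X Y : D} (f : Y ⟶ X) (A : Ty X) (t : Tm Y) (h : tp t = tySub f A),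
    pair f A t h ≫ proj A = f
  var_pair : ∀ {X Y : D} (f : Y ⟶ X) (A : Ty X) (t : Tm Y) (h : tp t = tySub f A),
    tmSub (pair f A t h) (var A) = t
  hom_ext : ∀ {X Y : D} {A : Ty X} (g g' : Y ⟶ ext A), g ≫ proj A = g' ≫ proj A →
    tmSub g (var A) = tmSub g' (var A) → g = g'

namespace CwF

variable {D : Type u} [Category.{v} D] (M : CwF.{w} D)

/-- The map `Y.A' ⟶ X.A` over `f : Y ⟶ X`, where `A' = A[f]`. -/
def lift {X Y : D} (f : Y ⟶ X) (A : M.Ty X) (A' : M.Ty Y) (h : A' = M.tySub f A) :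
    M.ext A' ⟶ M.ext A :=
  M.pair (M.proj A' ≫ f) A (M.var A') (by rw [M.tp_var, M.tySub_comp, h])

/-- The map `X ⟶ X.A` given by a term `a` of type `A`. -/
def inst {X : D} (A : M.Ty X) (a : M.Tm X) (h : M.tp a = A) : X ⟶ M.ext A :=
  M.pair (𝟙 X) A a (by rw [M.tySub_id, h])

theorem lift_proj {X Y : D} (f : Y ⟶ X) (A : M.Ty X) (A' : M.Ty Y) (h : A' = M.tySub f A) :
    M.lift f A A' h ≫ M.proj A = M.proj A' ≫ f :=
  M.pair_proj _ _ _ _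

theorem var_lift {X Y : D} (f : Y ⟶ X) (A : M.Ty X) (A' : M.Ty Y) (h : A' = M.tySub f A) :
    M.tmSub (M.lift f A A' h) (M.var A) = M.var A' :=
  M.var_pair _ _ _ _

theorem inst_proj {X : D} (A : M.Ty X) (a : M.Tm X) (h : M.tp a = A) :
    M.inst A a h ≫ M.proj A = 𝟙 X :=
  M.pair_proj _ _ _ _

theorem isPullback_lift {X Y : D} (f : Y ⟶ X) (A : M.Ty X) (A' : M.Ty Y)
    (h : A' = M.tySub f A) : IsPullback (M.lift f A A' h) (M.proj A') (M.proj A) f := by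
  refine ⟨⟨M.lift_proj f A A' h⟩, ⟨PullbackCone.IsLimit.mk _
    (fun s => M.pair s.snd A' (M.tmSub s.fst (M.var A)) ?_) ?_ ?_ ?_⟩⟩
  · rw [M.tp_tmSub, M.tp_var, ← M.tySub_comp, s.condition, M.tySub_comp, h]
  · intro s
    apply M.hom_ext
    · rw [Category.assoc, M.lift_proj, ← Category.assoc, M.pair_proj, s.condition]
    · rw [M.tmSub_comp, M.var_lift, M.var_pair]
  · intro s
    exact M.pair_proj _ _ _ _
  · intro s m h₁ h₂
    apply M.hom_ext
    · rw [M.pair_proj, h₂]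
    · rw [M.var_pair, ← h₁, M.tmSub_comp, M.var_lift]

end CwF

/-! ## Contextual categories -/

/-- A contextual category: a category of contexts with families, a terminal empty context, and a
length function such that the empty context is the only one of length `0` and every other context
is the extension of a unique context by a unique type. -/
structure ConCat where
  Ctx : Type u
  [category : Category.{v} Ctx]
  cwf : CwF.{w} Ctx
  empty : Ctx
  emptyIsTerminal : IsTerminal empty
  length : Ctx → ℕ
  length_eq_zero_iff : ∀ Γ : Ctx, length Γ = 0 ↔ Γ = empty
  length_ext : ∀ {Γ : Ctx} (A : cwf.Ty Γ), length (cwf.ext A) = length Γ + 1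
  existsUnique_ext : ∀ Γ : Ctx, length Γ ≠ 0 →
    ∃! A : (Σ Γ' : Ctx, cwf.Ty Γ'), cwf.ext A.2 = Γ

attribute [instance] ConCat.category

/-- A contextual functor: a functor with compatible actions on types and terms that preserves the
empty context, context extensions, projections and generic terms strictly. -/
structure ConFunctor (C : ConCat.{w₁, v₁, u₁}) (D : ConCat.{w₂, v₂, u₂}) where
  functor : C.Ctx ⥤ D.Ctx
  onTy : ∀ {Γ : C.Ctx}, C.cwf.Ty Γ → D.cwf.Ty (functor.obj Γ)
  onTm : ∀ {Γ : C.Ctx}, C.cwf.Tm Γ → D.cwf.Tm (functor.obj Γ)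
  tp_onTm : ∀ {Γ : C.Ctx} (t : C.cwf.Tm Γ), D.cwf.tp (onTm t) = onTy (C.cwf.tp t)
  onTy_tySub : ∀ {Γ Δ : C.Ctx} (f : Δ ⟶ Γ) (A : C.cwf.Ty Γ),
    onTy (C.cwf.tySub f A) = D.cwf.tySub (functor.map f) (onTy A)
  onTm_tmSub : ∀ {Γ Δ : C.Ctx} (f : Δ ⟶ Γ) (t : C.cwf.Tm Γ),
    onTm (C.cwf.tmSub f t) = D.cwf.tmSub (functor.map f) (onTm t)
  obj_empty : functor.obj C.empty = D.empty
  obj_ext : ∀ {Γ : C.Ctx} (A : C.cwf.Ty Γ), functor.obj (C.cwf.ext A) = D.cwf.ext (onTy A)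
  map_proj : ∀ {Γ : C.Ctx} (A : C.cwf.Ty Γ),
    functor.map (C.cwf.proj A) = eqToHom (obj_ext A) ≫ D.cwf.proj (onTy A)
  onTm_var : ∀ {Γ : C.Ctx} (A : C.cwf.Ty Γ),
    onTm (C.cwf.var A) = D.cwf.tmSub (eqToHom (obj_ext A)) (D.cwf.var (onTy A))

namespace ConFunctor

/-- The identity contextual functor. -/
def id (C : ConCat.{w, v, u}) : ConFunctor C C where
  functor := 𝟭 _
  onTy A := A
  onTm t := t
  tp_onTm _ := rfl
  onTy_tySub _ _ := rfl
  onTm_tmSub _ _ := rfl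
  obj_empty := rfl
  obj_ext _ := rfl
  map_proj _ := (Category.id_comp _).symm
  onTm_var _ := (C.cwf.tmSub_id _).symm

/-- The composite of contextual functors. -/
def comp {C : ConCat.{w₁, v₁, u₁}} {D : ConCat.{w₂, v₂, u₂}} {E : ConCat.{w, v₃, u₃}}
    (F : ConFunctor C D) (G : ConFunctor D E) : ConFunctor C E where
  functor := F.functor ⋙ G.functor
  onTy A := G.onTy (F.onTy A)
  onTm t := G.onTm (F.onTm t)
  tp_onTm t := by rw [G.tp_onTm, F.tp_onTm]
  onTy_tySub f A := by rw [F.onTy_tySub, G.onTy_tySub]; rfl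
  onTm_tmSub f t := by rw [F.onTm_tmSub, G.onTm_tmSub]; rfl
  obj_empty := (congrArg G.functor.obj F.obj_empty).trans G.obj_empty
  obj_ext A := (congrArg G.functor.obj (F.obj_ext A)).trans (G.obj_ext _)
  map_proj A := by
    rw [Functor.comp_map, F.map_proj, Functor.map_comp, G.map_proj, eqToHom_map, ← Category.assoc,
      eqToHom_trans]
  onTm_var A := by
    rw [F.onTm_var, G.onTm_tmSub, G.onTm_var, eqToHom_map, ← E.cwf.tmSub_comp, eqToHom_trans]

theorem ext_of_eqToHom {C : ConCat.{w₁, v₁, u₁}} {D : ConCat.{w₂, v₂, u₂}} {F G : ConFunctor C D}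
    (h : ∀ Γ, F.functor.obj Γ = G.functor.obj Γ)
    (hmap : ∀ {Γ Δ : C.Ctx} (f : Γ ⟶ Δ),
      F.functor.map f = eqToHom (h Γ) ≫ G.functor.map f ≫ eqToHom (h Δ).symm)
    (hTy : ∀ {Γ : C.Ctx} (A : C.cwf.Ty Γ), F.onTy A = D.cwf.tySub (eqToHom (h Γ)) (G.onTy A))
    (hTm : ∀ {Γ : C.Ctx} (t : C.cwf.Tm Γ), F.onTm t = D.cwf.tmSub (eqToHom (h Γ)) (G.onTm t)) :
    F = G := by
  obtain ⟨F₀, FTy, FTm, _, _, _, _, _, _, _⟩ := F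
  obtain ⟨G₀, GTy, GTm, _, _, _, _, _, _, _⟩ := G
  dsimp only at h hmap hTy hTm
  obtain rfl : F₀ = G₀ := CategoryTheory.Functor.ext h (fun _ _ f => hmap f)
  obtain rfl : @FTy = @GTy := by
    funext Γ A
    rw [hTy, eqToHom_refl, D.cwf.tySub_id]
  obtain rfl : @FTm = @GTm := by
    funext Γ t
    rw [hTm, eqToHom_refl, D.cwf.tmSub_id]
  rfl

end ConFunctor

/-- The category of contextual categories and contextual functors. -/
instance : Category ConCat.{w, v, u} where
  Hom := ConFunctor
  id := ConFunctor.id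
  comp := ConFunctor.comp

/-! ## Π-types -/

/-- A choice of Π-types (with β and η) in a contextual category, stable under substitution. -/
structure ConCat.PiStructure (C : ConCat.{w, v, u}) where
  Pi : ∀ {Γ : C.Ctx} (A : C.cwf.Ty Γ), C.cwf.Ty (C.cwf.ext A) → C.cwf.Ty Γ
  lam : ∀ {Γ : C.Ctx} (A : C.cwf.Ty Γ), C.cwf.Tm (C.cwf.ext A) → C.cwf.Tm Γ
  app : ∀ {Γ : C.Ctx} (A : C.cwf.Ty Γ) (B : C.cwf.Ty (C.cwf.ext A)) (f a : C.cwf.Tm Γ),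
    C.cwf.tp f = Pi A B → C.cwf.tp a = A → C.cwf.Tm Γ
  tp_lam : ∀ {Γ : C.Ctx} (A : C.cwf.Ty Γ) (b : C.cwf.Tm (C.cwf.ext A)),
    C.cwf.tp (lam A b) = Pi A (C.cwf.tp b)
  tp_app : ∀ {Γ : C.Ctx} (A : C.cwf.Ty Γ) (B : C.cwf.Ty (C.cwf.ext A)) (f a : C.cwf.Tm Γ)
    (hf : C.cwf.tp f = Pi A B) (ha : C.cwf.tp a = A),
    C.cwf.tp (app A B f a hf ha) = C.cwf.tySub (C.cwf.inst A a ha) B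
  Pi_sub : ∀ {Γ Δ : C.Ctx} (s : Δ ⟶ Γ) (A : C.cwf.Ty Γ) (B : C.cwf.Ty (C.cwf.ext A)),
    C.cwf.tySub s (Pi A B) = Pi (C.cwf.tySub s A) (C.cwf.tySub (C.cwf.lift s A _ rfl) B)
  lam_sub : ∀ {Γ Δ : C.Ctx} (s : Δ ⟶ Γ) (A : C.cwf.Ty Γ) (b : C.cwf.Tm (C.cwf.ext A)),
    C.cwf.tmSub s (lam A b) = lam (C.cwf.tySub s A) (C.cwf.tmSub (C.cwf.lift s A _ rfl) b)
  app_sub : ∀ {Γ Δ : C.Ctx} (s : Δ ⟶ Γ) (A : C.cwf.Ty Γ) (B : C.cwf.Ty (C.cwf.ext A))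
    (f a : C.cwf.Tm Γ) (hf : C.cwf.tp f = Pi A B) (ha : C.cwf.tp a = A),
    C.cwf.tmSub s (app A B f a hf ha) =
      app (C.cwf.tySub s A) (C.cwf.tySub (C.cwf.lift s A _ rfl) B)
        (C.cwf.tmSub s f) (C.cwf.tmSub s a)
        (by rw [C.cwf.tp_tmSub, hf, Pi_sub]) (by rw [C.cwf.tp_tmSub, ha])
  beta : ∀ {Γ : C.Ctx} (A : C.cwf.Ty Γ) (b : C.cwf.Tm (C.cwf.ext A)) (a : C.cwf.Tm Γ)
    (ha : C.cwf.tp a = A),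
    app A (C.cwf.tp b) (lam A b) a (tp_lam A b) ha = C.cwf.tmSub (C.cwf.inst A a ha) b
  eta : ∀ {Γ : C.Ctx} (A : C.cwf.Ty Γ) (B : C.cwf.Ty (C.cwf.ext A)) (f : C.cwf.Tm Γ)
    (hf : C.cwf.tp f = Pi A B),
    lam A (app (C.cwf.tySub (C.cwf.proj A) A)
      (C.cwf.tySub (C.cwf.lift (C.cwf.proj A) A _ rfl) B)
      (C.cwf.tmSub (C.cwf.proj A) f) (C.cwf.var A)
      (by rw [C.cwf.tp_tmSub, hf, Pi_sub]) (C.cwf.tp_var A)) = f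

/-- The unique map from a context to the empty context. -/
def ConCat.toEmpty (C : ConCat.{w, v, u}) (Δ : C.Ctx) : Δ ⟶ C.empty := C.emptyIsTerminal.from Δ

/-- A closed type, weakened to a context `Δ`. -/
def ConCat.wk (C : ConCat.{w, v, u}) (A : C.cwf.Ty C.empty) (Δ : C.Ctx) : C.cwf.Ty Δ :=
  C.cwf.tySub (C.toEmpty Δ) A

theorem ConCat.wk_eq (C : ConCat.{w, v, u}) (A : C.cwf.Ty C.empty) (Δ : C.Ctx) :
    C.wk A Δ = C.cwf.tySub (C.toEmpty Δ) A :=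
  rfl

/-- A type depending on one variable of a closed type `A`, weakened to the context `Δ.A`. -/
def ConCat.wkUnder (C : ConCat.{w, v, u}) (A : C.cwf.Ty C.empty) (B : C.cwf.Ty (C.cwf.ext A))
    (Δ : C.Ctx) : C.cwf.Ty (C.cwf.ext (C.wk A Δ)) :=
  C.cwf.tySub (C.cwf.lift (C.toEmpty Δ) A _ (C.wk_eq A Δ)) B

theorem ConCat.wk_sub (C : ConCat.{w, v, u}) (A : C.cwf.Ty C.empty) {Δ Δ' : C.Ctx} (s : Δ' ⟶ Δ) :
    C.wk A Δ' = C.cwf.tySub s (C.wk A Δ) := by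
  rw [wk, wk, ← C.cwf.tySub_comp, C.emptyIsTerminal.hom_ext (s ≫ C.toEmpty Δ) (C.toEmpty Δ')]

theorem ConCat.wkUnder_sub (C : ConCat.{w, v, u}) (A : C.cwf.Ty C.empty)
    (B : C.cwf.Ty (C.cwf.ext A)) {Δ Δ' : C.Ctx} (s : Δ' ⟶ Δ) :
    C.cwf.tySub (C.cwf.lift s (C.wk A Δ) (C.wk A Δ') (C.wk_sub A s)) (C.wkUnder A B Δ) =
      C.wkUnder A B Δ' := by
  rw [wkUnder, wkUnder, ← C.cwf.tySub_comp]
  congr 1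
  apply C.cwf.hom_ext
  · rw [Category.assoc, C.cwf.lift_proj, ← Category.assoc, C.cwf.lift_proj, C.cwf.lift_proj]
    exact C.emptyIsTerminal.hom_ext _ _
  · rw [C.cwf.tmSub_comp, C.cwf.var_lift, C.cwf.var_lift, C.cwf.var_lift]

theorem ConCat.wkUnder_inst_var (C : ConCat.{w, v, u}) (A : C.cwf.Ty C.empty)
    (B : C.cwf.Ty (C.cwf.ext A)) (Δ : C.Ctx)
    (h : C.cwf.tp (C.cwf.var (C.wk A Δ)) = C.wk A (C.cwf.ext (C.wk A Δ))) :
    C.cwf.tySub (C.cwf.inst _ (C.cwf.var (C.wk A Δ)) h) (C.wkUnder A B _) = C.wkUnder A B Δ := by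
  rw [wkUnder, wkUnder, ← C.cwf.tySub_comp]
  congr 1
  apply C.cwf.hom_ext
  · exact (C.emptyIsTerminal.hom_ext _ _)
  · rw [C.cwf.tmSub_comp, C.cwf.var_lift, C.cwf.var_lift]
    exact C.cwf.var_pair _ _ _ _

/-- A choice of Π-types (with β and η) in the empty context: `Pi A B` is formed only for closed `A`
and for `B` depending on one variable of type `A`, but abstraction and application are available for
terms in an arbitrary context `Δ`. -/
structure ConCat.EmptyPiStructure (C : ConCat.{w, v, u}) where
  Pi : ∀ (A : C.cwf.Ty C.empty), C.cwf.Ty (C.cwf.ext A) → C.cwf.Ty C.empty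
  lam : ∀ (A : C.cwf.Ty C.empty) (B : C.cwf.Ty (C.cwf.ext A)) {Δ : C.Ctx}
    (b : C.cwf.Tm (C.cwf.ext (C.wk A Δ))), C.cwf.tp b = C.wkUnder A B Δ → C.cwf.Tm Δ
  app : ∀ (A : C.cwf.Ty C.empty) (B : C.cwf.Ty (C.cwf.ext A)) {Δ : C.Ctx} (f a : C.cwf.Tm Δ),
    C.cwf.tp f = C.wk (Pi A B) Δ → C.cwf.tp a = C.wk A Δ → C.cwf.Tm Δ
  tp_lam : ∀ (A : C.cwf.Ty C.empty) (B : C.cwf.Ty (C.cwf.ext A)) {Δ : C.Ctx}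
    (b : C.cwf.Tm (C.cwf.ext (C.wk A Δ))) (hb : C.cwf.tp b = C.wkUnder A B Δ),
    C.cwf.tp (lam A B b hb) = C.wk (Pi A B) Δ
  tp_app : ∀ (A : C.cwf.Ty C.empty) (B : C.cwf.Ty (C.cwf.ext A)) {Δ : C.Ctx} (f a : C.cwf.Tm Δ)
    (hf : C.cwf.tp f = C.wk (Pi A B) Δ) (ha : C.cwf.tp a = C.wk A Δ),
    C.cwf.tp (app A B f a hf ha) =
      C.cwf.tySub (C.cwf.inst (C.wk A Δ) a ha) (C.wkUnder A B Δ)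
  lam_sub : ∀ (A : C.cwf.Ty C.empty) (B : C.cwf.Ty (C.cwf.ext A)) {Δ Δ' : C.Ctx} (s : Δ' ⟶ Δ)
    (b : C.cwf.Tm (C.cwf.ext (C.wk A Δ))) (hb : C.cwf.tp b = C.wkUnder A B Δ),
    C.cwf.tmSub s (lam A B b hb) =
      lam A B (C.cwf.tmSub (C.cwf.lift s (C.wk A Δ) (C.wk A Δ') (C.wk_sub A s)) b)
        (by rw [C.cwf.tp_tmSub, hb, C.wkUnder_sub])
  app_sub : ∀ (A : C.cwf.Ty C.empty) (B : C.cwf.Ty (C.cwf.ext A)) {Δ Δ' : C.Ctx} (s : Δ' ⟶ Δ)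
    (f a : C.cwf.Tm Δ) (hf : C.cwf.tp f = C.wk (Pi A B) Δ) (ha : C.cwf.tp a = C.wk A Δ),
    C.cwf.tmSub s (app A B f a hf ha) =
      app A B (C.cwf.tmSub s f) (C.cwf.tmSub s a)
        (by rw [C.cwf.tp_tmSub, hf, ← C.wk_sub]) (by rw [C.cwf.tp_tmSub, ha, ← C.wk_sub])
  beta : ∀ (A : C.cwf.Ty C.empty) (B : C.cwf.Ty (C.cwf.ext A)) {Δ : C.Ctx}
    (b : C.cwf.Tm (C.cwf.ext (C.wk A Δ))) (hb : C.cwf.tp b = C.wkUnder A B Δ)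
    (a : C.cwf.Tm Δ) (ha : C.cwf.tp a = C.wk A Δ),
    app A B (lam A B b hb) a (tp_lam A B b hb) ha =
      C.cwf.tmSub (C.cwf.inst (C.wk A Δ) a ha) b
  eta : ∀ (A : C.cwf.Ty C.empty) (B : C.cwf.Ty (C.cwf.ext A)) {Δ : C.Ctx} (f : C.cwf.Tm Δ)
    (hf : C.cwf.tp f = C.wk (Pi A B) Δ),
    lam A B (app A B (C.cwf.tmSub (C.cwf.proj (C.wk A Δ)) f) (C.cwf.var (C.wk A Δ))
        (by rw [C.cwf.tp_tmSub, hf, ← C.wk_sub]) (by rw [C.cwf.tp_var, ← C.wk_sub]))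
      (by rw [tp_app, C.wkUnder_inst_var]) = f

namespace ConFunctor

variable {C : ConCat.{w₁, v₁, u₁}} {D : ConCat.{w₂, v₂, u₂}} (F : ConFunctor C D)

/-- The action of a contextual functor on types depending on a variable of type `A`. -/
def onTyExt {Γ : C.Ctx} (A : C.cwf.Ty Γ) (B : C.cwf.Ty (C.cwf.ext A)) :
    D.cwf.Ty (D.cwf.ext (F.onTy A)) :=
  D.cwf.tySub (eqToHom (F.obj_ext A).symm) (F.onTy B)

/-- The action of a contextual functor on terms depending on a variable of type `A`. -/
def onTmExt {Γ : C.Ctx} (A : C.cwf.Ty Γ) (b : C.cwf.Tm (C.cwf.ext A)) :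
    D.cwf.Tm (D.cwf.ext (F.onTy A)) :=
  D.cwf.tmSub (eqToHom (F.obj_ext A).symm) (F.onTm b)

theorem tp_onTmExt {Γ : C.Ctx} (A : C.cwf.Ty Γ) (b : C.cwf.Tm (C.cwf.ext A)) :
    D.cwf.tp (F.onTmExt A b) = F.onTyExt A (C.cwf.tp b) := by
  rw [onTmExt, D.cwf.tp_tmSub, F.tp_onTm, onTyExt]

/-- The action of a contextual functor on closed types. -/
def onTyEmpty (A : C.cwf.Ty C.empty) : D.cwf.Ty D.empty :=
  D.cwf.tySub (eqToHom F.obj_empty.symm) (F.onTy A)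

theorem onTy_wk (A : C.cwf.Ty C.empty) (Δ : C.Ctx) :
    F.onTy (C.wk A Δ) = D.wk (F.onTyEmpty A) (F.functor.obj Δ) := by
  rw [ConCat.wk, ConCat.wk, F.onTy_tySub, onTyEmpty, ← D.cwf.tySub_comp]
  congr 1
  rw [← cancel_mono (eqToHom F.obj_empty)]
  exact D.emptyIsTerminal.hom_ext _ _

theorem obj_extEmpty (A : C.cwf.Ty C.empty) :
    F.functor.obj (C.cwf.ext A) = D.cwf.ext (F.onTyEmpty A) := by
  rw [F.obj_ext, onTyEmpty]
  generalize_proofs h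
  revert h
  generalize F.onTy A = A'
  revert A'
  generalize F.functor.obj C.empty = X
  intro A' h
  subst h
  rw [eqToHom_refl, D.cwf.tySub_id]

/-- The action of a contextual functor on types depending on one variable of a closed type. -/
def onTyExtEmpty (A : C.cwf.Ty C.empty) (B : C.cwf.Ty (C.cwf.ext A)) :
    D.cwf.Ty (D.cwf.ext (F.onTyEmpty A)) :=
  D.cwf.tySub (eqToHom (F.obj_extEmpty A).symm) (F.onTy B)

theorem obj_ext_wk (A : C.cwf.Ty C.empty) (Δ : C.Ctx) :
    F.functor.obj (C.cwf.ext (C.wk A Δ)) = D.cwf.ext (D.wk (F.onTyEmpty A) (F.functor.obj Δ)) := by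
  rw [F.obj_ext, F.onTy_wk]

theorem var_eqToHom {X : D.Ctx} {A A' : D.cwf.Ty X} (h : A = A')
    (h' : D.cwf.ext A = D.cwf.ext A') :
    D.cwf.tmSub (eqToHom h') (D.cwf.var A') = D.cwf.var A := by
  subst h
  exact D.cwf.tmSub_id _

theorem var_eqToHom_empty {X Y : D.Ctx} (e : X = Y) (A : D.cwf.Ty Y)
    (h : D.cwf.ext (D.cwf.tySub (eqToHom e) A) = D.cwf.ext A) :
    D.cwf.tmSub (eqToHom h) (D.cwf.var A) = D.cwf.var (D.cwf.tySub (eqToHom e) A) := by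
  subst e
  exact var_eqToHom (D.cwf.tySub_id A) _

theorem var_onTyEmpty (A : C.cwf.Ty C.empty) :
    D.cwf.tmSub (eqToHom (F.obj_extEmpty A)) (D.cwf.var (F.onTyEmpty A)) =
      F.onTm (C.cwf.var A) := by
  have h : D.cwf.ext (F.onTyEmpty A) = D.cwf.ext (F.onTy A) := by
    rw [← F.obj_extEmpty, F.obj_ext]
  have h₁ : D.cwf.tmSub (eqToHom h) (D.cwf.var (F.onTy A)) = D.cwf.var (F.onTyEmpty A) :=
    var_eqToHom_empty F.obj_empty.symm (F.onTy A) h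
  have h₂ : D.cwf.var (F.onTyEmpty A) = D.cwf.tmSub (eqToHom h) (D.cwf.var (F.onTy A)) := h₁.symm
  rw [h₂, ← D.cwf.tmSub_comp, eqToHom_trans, F.onTm_var]

theorem onTy_wkUnder (A : C.cwf.Ty C.empty) (B : C.cwf.Ty (C.cwf.ext A)) (Δ : C.Ctx) :
    D.cwf.tySub (eqToHom (F.obj_ext_wk A Δ).symm) (F.onTy (C.wkUnder A B Δ)) =
      D.wkUnder (F.onTyEmpty A) (F.onTyExtEmpty A B) (F.functor.obj Δ) := by
  rw [ConCat.wkUnder, ConCat.wkUnder, F.onTy_tySub, onTyExtEmpty, ← D.cwf.tySub_comp,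
    ← D.cwf.tySub_comp]
  congr 1
  rw [← cancel_mono (eqToHom (F.obj_extEmpty A))]
  apply D.cwf.hom_ext
  · exact D.emptyIsTerminal.hom_ext _ _
  · rw [Category.assoc, Category.assoc, eqToHom_trans, eqToHom_refl, Category.comp_id,
      D.cwf.var_lift, D.cwf.tmSub_comp, D.cwf.tmSub_comp, F.var_onTyEmpty, ← F.onTm_tmSub,
      C.cwf.var_lift, F.onTm_var, ← D.cwf.tmSub_comp, eqToHom_trans]
    exact var_eqToHom (F.onTy_wk A Δ).symm _

/-- A contextual functor preserves the chosen Π-types, abstractions and applications strictly. -/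
structure PreservesPi (P : C.PiStructure) (Q : D.PiStructure) : Prop where
  onTy_Pi : ∀ {Γ : C.Ctx} (A : C.cwf.Ty Γ) (B : C.cwf.Ty (C.cwf.ext A)),
    F.onTy (P.Pi A B) = Q.Pi (F.onTy A) (F.onTyExt A B)
  onTm_lam : ∀ {Γ : C.Ctx} (A : C.cwf.Ty Γ) (b : C.cwf.Tm (C.cwf.ext A)),
    F.onTm (P.lam A b) = Q.lam (F.onTy A) (F.onTmExt A b)
  onTm_app : ∀ {Γ : C.Ctx} (A : C.cwf.Ty Γ) (B : C.cwf.Ty (C.cwf.ext A)) (f a : C.cwf.Tm Γ)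
    (hf : C.cwf.tp f = P.Pi A B) (ha : C.cwf.tp a = A),
    F.onTm (P.app A B f a hf ha) =
      Q.app (F.onTy A) (F.onTyExt A B) (F.onTm f) (F.onTm a)
        (by rw [F.tp_onTm, hf, onTy_Pi]) (by rw [F.tp_onTm, ha])

/-- A contextual functor preserves the chosen Π-types in the empty context, abstractions and
applications strictly. -/
structure PreservesEmptyPi (P : C.EmptyPiStructure) (Q : D.EmptyPiStructure) : Prop where
  onTy_Pi : ∀ (A : C.cwf.Ty C.empty) (B : C.cwf.Ty (C.cwf.ext A)),
    F.onTyEmpty (P.Pi A B) = Q.Pi (F.onTyEmpty A) (F.onTyExtEmpty A B)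
  onTm_lam : ∀ (A : C.cwf.Ty C.empty) (B : C.cwf.Ty (C.cwf.ext A)) {Δ : C.Ctx}
    (b : C.cwf.Tm (C.cwf.ext (C.wk A Δ))) (hb : C.cwf.tp b = C.wkUnder A B Δ),
    F.onTm (P.lam A B b hb) =
      Q.lam (F.onTyEmpty A) (F.onTyExtEmpty A B)
        (D.cwf.tmSub (eqToHom (F.obj_ext_wk A Δ).symm) (F.onTm b))
        (by rw [D.cwf.tp_tmSub, F.tp_onTm, hb, F.onTy_wkUnder])
  onTm_app : ∀ (A : C.cwf.Ty C.empty) (B : C.cwf.Ty (C.cwf.ext A)) {Δ : C.Ctx} (f a : C.cwf.Tm Δ)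
    (hf : C.cwf.tp f = C.wk (P.Pi A B) Δ) (ha : C.cwf.tp a = C.wk A Δ),
    F.onTm (P.app A B f a hf ha) =
      Q.app (F.onTyEmpty A) (F.onTyExtEmpty A B) (F.onTm f) (F.onTm a)
        (by rw [F.tp_onTm, hf, F.onTy_wk, onTy_Pi]) (by rw [F.tp_onTm, ha, F.onTy_wk])

end ConFunctor

/-! ## Contextually indexed contextual categories -/

/-- A contextually indexed contextual category: a contextual category `base` together with a
functor from the opposite of its category of contexts to contextual categories. -/
structure IndexedConCat where
  base : ConCat.{w₁, v₁, u₁}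
  fiber : base.Ctxᵒᵖ ⥤ ConCat.{w₂, v₂, u₂}

namespace IndexedConCat

variable (C : IndexedConCat.{w₁, w₂, v₁, v₂, u₁, u₂})

/-- Every fibre has Π-types stable under substitution, and they are stable under reindexing. -/
def HasPiTypes : Prop :=
  ∃ P : ∀ Γ, (C.fiber.obj Γ).PiStructure,
    ∀ {Γ Δ : C.base.Ctxᵒᵖ} (s : Γ ⟶ Δ), ConFunctor.PreservesPi (C.fiber.map s) (P Γ) (P Δ)

/-- Cartesian closedness: every fibre has Π-types in the empty context, and they are stable under
reindexing. -/
def IsCartesianClosed : Prop :=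
  ∃ P : ∀ Γ, (C.fiber.obj Γ).EmptyPiStructure,
    ∀ {Γ Δ : C.base.Ctxᵒᵖ} (s : Γ ⟶ Δ), ConFunctor.PreservesEmptyPi (C.fiber.map s) (P Γ) (P Δ)

end IndexedConCat

/-! ## Contexts over an object of a category with families -/

/-- `Tel M X Y`: finite sequences of context extensions starting from `X`, with result `Y`. -/
inductive Tel {D : Type u} [Category.{v} D] (M : CwF.{w} D) (X : D) : D → Type (max u w)
  | nil : Tel M X X
  | snoc {Y : D} (T : Tel M X Y) (A : M.Ty Y) : Tel M X (M.ext A)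

namespace Tel

variable {D : Type u} [Category.{v} D] {M : CwF.{w} D}

/-- The number of extensions. -/
def length {X : D} : ∀ {Y : D}, Tel M X Y → ℕ
  | _, nil => 0
  | _, snoc T _ => length T + 1

/-- The composite of projections from the result to the initial object. -/
def root {X : D} : ∀ {Y : D}, Tel M X Y → (Y ⟶ X)
  | _, nil => 𝟙 X
  | _, snoc T A => M.proj A ≫ root T

/-- Substitution along `f : X' ⟶ X`: the result is an object `Y'`, a sequence of extensions of `X'`
with result `Y'`, and a map `Y' ⟶ Y` over `f`. -/
def reindex {X X' : D} (f : X' ⟶ X) : ∀ {Y : D}, Tel M X Y → Σ Y' : D, Tel M X' Y' × (Y' ⟶ Y)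
  | _, nil => ⟨X', nil, f⟩
  | _, snoc T A =>
    let r := reindex f T
    ⟨_, snoc r.2.1 (M.tySub r.2.2 A), M.lift r.2.2 A _ rfl⟩

theorem isPullback_reindex {X X' : D} (f : X' ⟶ X) {Y : D} (T : Tel M X Y) :
    IsPullback (T.reindex f).2.2 (T.reindex f).2.1.root T.root f := by
  induction T with
  | nil =>
    have h : IsPullback f (𝟙 X') (𝟙 X) f := IsPullback.of_vert_isIso ⟨by simp⟩
    exact h
  | snoc T A ih => exact (M.isPullback_lift _ A _ rfl).paste_vert ih

theorem length_reindex {X X' : D} (f : X' ⟶ X) {Y : D} (T : Tel M X Y) :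
    (T.reindex f).2.1.length = T.length := by
  induction T with
  | nil => rfl
  | snoc T A ih => exact congrArg (· + 1) ih

end Tel

namespace CwF

variable {D : Type u} [Category.{v} D] (M : CwF.{w} D)

theorem snoc_lift_eq {X Y Y' : D} (T : Tel M X Y) (A : M.Ty Y) (T' : Tel M X Y') (m : Y' ⟶ Y)
    (h : (⟨Y', T', m⟩ : Σ Y' : D, Tel M X Y' × (Y' ⟶ Y)) = ⟨Y, T, 𝟙 Y⟩) :
    (⟨_, T'.snoc (M.tySub m A), M.lift m A _ rfl⟩ :
      Σ Y' : D, Tel M X Y' × (Y' ⟶ M.ext A)) = ⟨_, T.snoc A, 𝟙 _⟩ := by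
  cases h
  have key : ∀ (A' : M.Ty Y) (h' : A' = M.tySub (𝟙 Y) A),
      (⟨_, T.snoc A', M.lift (𝟙 Y) A A' h'⟩ :
        Σ Y' : D, Tel M X Y' × (Y' ⟶ M.ext A)) = ⟨_, T.snoc A, 𝟙 _⟩ := by
    intro A' h'
    obtain rfl : A' = A := h'.trans (M.tySub_id A)
    congr 2
    apply M.hom_ext
    · rw [M.lift_proj, Category.comp_id, Category.id_comp]
    · rw [M.var_lift, M.tmSub_id]
  exact key _ rfl

end CwF

theorem Tel.reindex_id {D : Type u} [Category.{v} D] {M : CwF.{w} D} {X Y : D} (T : Tel M X Y) :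
    T.reindex (𝟙 X) = ⟨Y, T, 𝟙 Y⟩ := by
  induction T with
  | nil => rfl
  | snoc T A ih => exact M.snoc_lift_eq T A _ _ ih

theorem Tel.reindex_comp {D : Type u} [Category.{v} D] {M : CwF.{w} D} {X X' X'' Y : D}
    (g : X'' ⟶ X') (f : X' ⟶ X) (T : Tel M X Y) :
    T.reindex (g ≫ f) = ⟨((T.reindex f).2.1.reindex g).1, ((T.reindex f).2.1.reindex g).2.1,
      ((T.reindex f).2.1.reindex g).2.2 ≫ (T.reindex f).2.2⟩ := by
  induction T with
  | nil => rfl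
  | @snoc Y T A ih =>
    have key : ∀ {Y₁ Y₂ : D} (T₂ : Tel M X'' Y₂) (m : Y₁ ⟶ Y) (n : Y₂ ⟶ Y₁)
        (r : Σ Y' : D, Tel M X'' Y' × (Y' ⟶ Y)) (_ : r = ⟨Y₂, T₂, n ≫ m⟩),
        (⟨_, r.2.1.snoc (M.tySub r.2.2 A), M.lift r.2.2 A _ rfl⟩ :
          Σ Y' : D, Tel M X'' Y' × (Y' ⟶ M.ext A)) =
        ⟨_, T₂.snoc (M.tySub n (M.tySub m A)), M.lift n _ _ rfl ≫ M.lift m A _ rfl⟩ := by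
      intro Y₁ Y₂ T₂ m n r hr
      subst hr
      have key' : ∀ (A' : M.Ty Y₂) (h' : A' = M.tySub n (M.tySub m A))
          (h'' : A' = M.tySub (n ≫ m) A),
          (⟨_, T₂.snoc A', M.lift (n ≫ m) A A' h''⟩ :
            Σ Y' : D, Tel M X'' Y' × (Y' ⟶ M.ext A)) =
          ⟨_, T₂.snoc (M.tySub n (M.tySub m A)), M.lift n _ _ rfl ≫ M.lift m A _ rfl⟩ := by
        intro A' h' h''
        subst h'
        congr 2
        apply M.hom_ext
        · rw [M.lift_proj, Category.assoc, M.lift_proj, ← Category.assoc, ← Category.assoc,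
            M.lift_proj]
        · rw [M.var_lift, M.tmSub_comp, M.var_lift, M.var_lift]
      exact key' _ (M.tySub_comp n m A) rfl
    exact key _ _ _ _ ih

namespace CwF

variable {D : Type u} [Category.{v} D] (M : CwF.{w} D)

/-- A context over `X`: an iterated context extension of `X`. -/
structure CtxOver (X : D) where
  obj : D
  tel : Tel M X obj

namespace CtxOver

variable {M}

/-- A map of contexts over `X` is a map of their underlying objects commuting with the projections
to `X`. -/
@[ext]
structure Hom {X : D} (Γ Δ : M.CtxOver X) where
  map : Γ.obj ⟶ Δ.obj
  w : map ≫ Δ.tel.root = Γ.tel.root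

instance {X : D} : Category (M.CtxOver X) where
  Hom := Hom
  id Γ := ⟨𝟙 _, Category.id_comp _⟩
  comp f g := ⟨f.map ≫ g.map, by rw [Category.assoc, g.w, f.w]⟩
  id_comp f := Hom.ext (Category.id_comp _)
  comp_id f := Hom.ext (Category.comp_id _)
  assoc f g h := Hom.ext (Category.assoc _ _ _)

@[ext]
theorem hom_ext {X : D} {Γ Δ : M.CtxOver X} {f g : Γ ⟶ Δ} (h : f.map = g.map) : f = g :=
  Hom.ext h

@[simp]
theorem comp_map {X : D} {Γ Δ Θ : M.CtxOver X} (f : Γ ⟶ Δ) (g : Δ ⟶ Θ) :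
    (f ≫ g).map = f.map ≫ g.map :=
  rfl

@[simp]
theorem id_map {X : D} (Γ : M.CtxOver X) : Hom.map (𝟙 Γ) = 𝟙 Γ.obj :=
  rfl

theorem eqToHom_map {X : D} {Γ Δ : M.CtxOver X} (h : Γ = Δ) :
    (eqToHom h).map = eqToHom (congrArg CtxOver.obj h) := by
  subst h
  rfl

/-- The previous context and the last type of a nonempty context. -/
def last {X : D} : M.CtxOver X → Option (Σ Γ : M.CtxOver X, M.Ty Γ.obj)
  | ⟨_, Tel.nil⟩ => none
  | ⟨_, Tel.snoc T A⟩ => some ⟨⟨_, T⟩, A⟩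

end CtxOver

/-- The contextual category of contexts over an object `X`. -/
def conCat (X : D) : ConCat.{w, v, max u w} where
  Ctx := M.CtxOver X
  cwf :=
    { Ty := fun Γ => M.Ty Γ.obj
      Tm := fun Γ => M.Tm Γ.obj
      tp := M.tp
      tySub := fun f A => M.tySub f.map A
      tmSub := fun f t => M.tmSub f.map t
      tySub_id := M.tySub_id
      tySub_comp := fun g f A => M.tySub_comp g.map f.map A
      tmSub_id := M.tmSub_id
      tmSub_comp := fun g f A => M.tmSub_comp g.map f.map A
      tp_tmSub := fun f t => M.tp_tmSub f.map t
      ext := fun {Γ} A => ⟨M.ext A, Γ.tel.snoc A⟩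
      proj := fun A => ⟨M.proj A, rfl⟩
      var := fun A => M.var A
      tp_var := fun A => M.tp_var A
      pair := fun f A t h => ⟨M.pair f.map A t h, by
        rw [Tel.root, ← Category.assoc, M.pair_proj, f.w]⟩
      pair_proj := fun f A t h => CtxOver.hom_ext (M.pair_proj f.map A t h)
      var_pair := fun f A t h => M.var_pair f.map A t h
      hom_ext := fun g g' h₁ h₂ =>
        CtxOver.hom_ext (M.hom_ext g.map g'.map (congrArg CtxOver.Hom.map h₁) h₂) }
  empty := ⟨X, Tel.nil⟩
  emptyIsTerminal := IsTerminal.ofUniqueHom (fun Γ => ⟨Γ.tel.root, Category.comp_id _⟩)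
    (fun Γ m => CtxOver.hom_ext ((Category.comp_id _).symm.trans m.w))
  length Γ := Γ.tel.length
  length_eq_zero_iff := by
    rintro ⟨Y, T⟩
    constructor
    · intro h
      cases T with
      | nil => rfl
      | snoc T A => exact absurd h (Nat.succ_ne_zero _)
    · intro h
      cases h
      rfl
  length_ext _ := rfl
  existsUnique_ext := by
    rintro ⟨Y, T⟩ h
    cases T with
    | nil => exact absurd rfl h
    | @snoc Y T A =>
      refine ⟨⟨⟨Y, T⟩, A⟩, rfl, ?_⟩
      rintro ⟨⟨Y', T'⟩, A'⟩ h'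
      exact Option.some.inj (congrArg CtxOver.last h')

/-- The reindexing of a context over `X` along `f : X' ⟶ X`. -/
def reindexObj {X X' : D} (f : X' ⟶ X) (Γ : M.CtxOver X) : M.CtxOver X' :=
  ⟨(Γ.tel.reindex f).1, (Γ.tel.reindex f).2.1⟩

/-- The canonical map from the reindexing of a context along `f` to this context. -/
def reindexMap {X X' : D} (f : X' ⟶ X) (Γ : M.CtxOver X) : (M.reindexObj f Γ).obj ⟶ Γ.obj :=
  (Γ.tel.reindex f).2.2

theorem isPullback_reindexMap {X X' : D} (f : X' ⟶ X) (Γ : M.CtxOver X) :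
    IsPullback (M.reindexMap f Γ) (M.reindexObj f Γ).tel.root Γ.tel.root f :=
  Γ.tel.isPullback_reindex f

/-- The reindexing of a map of contexts over `X` along `f : X' ⟶ X`, by the universal property of
pullbacks. -/
noncomputable def reindexHom {X X' : D} (f : X' ⟶ X) {Γ Δ : M.CtxOver X} (g : Γ ⟶ Δ) :
    M.reindexObj f Γ ⟶ M.reindexObj f Δ :=
  ⟨(M.isPullback_reindexMap f Δ).lift (M.reindexMap f Γ ≫ g.map) (M.reindexObj f Γ).tel.root
      (by rw [Category.assoc, g.w, (M.isPullback_reindexMap f Γ).w]),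
    (M.isPullback_reindexMap f Δ).lift_snd _ _ _⟩

theorem reindexHom_fst {X X' : D} (f : X' ⟶ X) {Γ Δ : M.CtxOver X} (g : Γ ⟶ Δ) :
    (M.reindexHom f g).map ≫ M.reindexMap f Δ = M.reindexMap f Γ ≫ g.map :=
  (M.isPullback_reindexMap f Δ).lift_fst _ _ _

theorem reindexHom_unique {X X' : D} (f : X' ⟶ X) {Γ : M.CtxOver X'} {Δ : M.CtxOver X}
    (g h : Γ ⟶ M.reindexObj f Δ)
    (w : g.map ≫ M.reindexMap f Δ = h.map ≫ M.reindexMap f Δ) : g = h :=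
  CtxOver.hom_ext ((M.isPullback_reindexMap f Δ).hom_ext w (g.w.trans h.w.symm))

/-- Reindexing along `f : X' ⟶ X`, as a functor. -/
noncomputable def reindexFunctor {X X' : D} (f : X' ⟶ X) : M.CtxOver X ⥤ M.CtxOver X' where
  obj := M.reindexObj f
  map := M.reindexHom f
  map_id Γ := M.reindexHom_unique f _ _ (by
    rw [M.reindexHom_fst, CtxOver.id_map, CtxOver.id_map, Category.comp_id, Category.id_comp])
  map_comp g h := M.reindexHom_unique f _ _ (by
    rw [M.reindexHom_fst, CtxOver.comp_map, CtxOver.comp_map, Category.assoc, M.reindexHom_fst,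
      ← Category.assoc, ← Category.assoc, M.reindexHom_fst])

/-- The extension of a context over `X` by a type. -/
def extObj {X : D} (Γ : M.CtxOver X) (A : M.Ty Γ.obj) : M.CtxOver X := ⟨M.ext A, Γ.tel.snoc A⟩

/-- The projection from the extension of a context over `X` by a type. -/
def extProj {X : D} (Γ : M.CtxOver X) (A : M.Ty Γ.obj) : M.extObj Γ A ⟶ Γ := ⟨M.proj A, rfl⟩

theorem reindexHom_proj {X X' : D} (f : X' ⟶ X) (Γ : M.CtxOver X) (A : M.Ty Γ.obj) :
    M.reindexHom f (M.extProj Γ A) =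
      M.extProj (M.reindexObj f Γ) (M.tySub (M.reindexMap f Γ) A) :=
  M.reindexHom_unique f _ _
    ((M.reindexHom_fst f (M.extProj Γ A)).trans (M.lift_proj (M.reindexMap f Γ) A _ rfl))

/-- Reindexing along `f : X' ⟶ X`, as a contextual functor. -/
noncomputable def reindex {X X' : D} (f : X' ⟶ X) : ConFunctor (M.conCat X) (M.conCat X') where
  functor := M.reindexFunctor f
  onTy {Γ} A := M.tySub (M.reindexMap f Γ) A
  onTm {Γ} t := M.tmSub (M.reindexMap f Γ) t
  tp_onTm t := M.tp_tmSub _ t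
  onTy_tySub g A :=
    (M.tySub_comp _ _ _).symm.trans
      ((congrArg (fun m => M.tySub m A) (M.reindexHom_fst f g).symm).trans (M.tySub_comp _ _ _))
  onTm_tmSub g t :=
    (M.tmSub_comp _ _ _).symm.trans
      ((congrArg (fun m => M.tmSub m t) (M.reindexHom_fst f g).symm).trans (M.tmSub_comp _ _ _))
  obj_empty := rfl
  obj_ext _ := rfl
  map_proj {Γ} A := (M.reindexHom_proj f Γ A).trans (Category.id_comp _).symm
  onTm_var {Γ} A := (M.var_lift (M.reindexMap f Γ) A _ rfl).trans (M.tmSub_id _).symm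

theorem reindexMap_id {X : D} (Γ : M.CtxOver X) :
    ∃ h : M.reindexObj (𝟙 X) Γ = Γ, M.reindexMap (𝟙 X) Γ = (eqToHom h).map := by
  obtain ⟨Y, T⟩ := Γ
  unfold reindexMap reindexObj
  dsimp only
  rw [T.reindex_id]
  exact ⟨rfl, rfl⟩

theorem reindexMap_comp {X X' X'' : D} (g : X'' ⟶ X') (f : X' ⟶ X) (Γ : M.CtxOver X) :
    ∃ h : M.reindexObj (g ≫ f) Γ = M.reindexObj g (M.reindexObj f Γ),
      M.reindexMap (g ≫ f) Γ =
        (eqToHom h).map ≫ M.reindexMap g (M.reindexObj f Γ) ≫ M.reindexMap f Γ := by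
  obtain ⟨Y, T⟩ := Γ
  unfold reindexMap reindexObj
  dsimp only
  rw [T.reindex_comp]
  exact ⟨rfl, (Category.id_comp _).symm⟩

theorem eqToHom_map_cancel {X : D} {Γ Δ : M.CtxOver X} (h : Γ = Δ) :
    (eqToHom h.symm).map ≫ (eqToHom h).map = 𝟙 _ := by
  rw [← CtxOver.comp_map, eqToHom_trans, eqToHom_refl, CtxOver.id_map]

theorem reindexHom_id {X : D} {Γ Δ : M.CtxOver X} (k : Γ ⟶ Δ) :
    M.reindexHom (𝟙 X) k = eqToHom (M.reindexMap_id Γ).1 ≫ k ≫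
      eqToHom (M.reindexMap_id Δ).1.symm := by
  apply M.reindexHom_unique
  rw [M.reindexHom_fst, (M.reindexMap_id Γ).2, (M.reindexMap_id Δ).2, CtxOver.comp_map,
    CtxOver.comp_map, Category.assoc, Category.assoc, M.eqToHom_map_cancel, Category.comp_id]

theorem reindexHom_comp {X X' X'' : D} (g : X'' ⟶ X') (f : X' ⟶ X) {Γ Δ : M.CtxOver X}
    (k : Γ ⟶ Δ) :
    M.reindexHom (g ≫ f) k = eqToHom (M.reindexMap_comp g f Γ).1 ≫
      M.reindexHom g (M.reindexHom f k) ≫ eqToHom (M.reindexMap_comp g f Δ).1.symm := by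
  apply M.reindexHom_unique
  rw [M.reindexHom_fst, (M.reindexMap_comp g f Γ).2, (M.reindexMap_comp g f Δ).2,
    CtxOver.comp_map, CtxOver.comp_map]
  have e := M.eqToHom_map_cancel (M.reindexMap_comp g f Δ).1
  have e₁ := M.reindexHom_fst g (M.reindexHom f k)
  simp only [Category.assoc, reassoc_of% e, reassoc_of% e₁, M.reindexHom_fst]

theorem reindex_id (X : D) : M.reindex (𝟙 X) = ConFunctor.id (M.conCat X) :=
  ConFunctor.ext_of_eqToHom (fun Γ => (M.reindexMap_id Γ).1) (fun f => M.reindexHom_id f)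
    (fun {Γ} A => congrArg (fun m => M.tySub m A) (M.reindexMap_id Γ).2)
    (fun {Γ} t => congrArg (fun m => M.tmSub m t) (M.reindexMap_id Γ).2)

theorem reindex_comp {X X' X'' : D} (g : X'' ⟶ X') (f : X' ⟶ X) :
    M.reindex (g ≫ f) = (M.reindex f).comp (M.reindex g) :=
  ConFunctor.ext_of_eqToHom (fun Γ => (M.reindexMap_comp g f Γ).1)
    (fun k => M.reindexHom_comp g f k)
    (fun {Γ} A => (congrArg (fun m => M.tySub m A) (M.reindexMap_comp g f Γ).2).trans
      ((M.tySub_comp _ _ _).trans (congrArg _ (M.tySub_comp _ _ _))))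
    (fun {Γ} t => (congrArg (fun m => M.tmSub m t) (M.reindexMap_comp g f Γ).2).trans
      ((M.tmSub_comp _ _ _).trans (congrArg _ (M.tmSub_comp _ _ _))))

/-- The contextual categories of contexts over the objects of `D`, with reindexing. -/
noncomputable def conCatFunctor : Dᵒᵖ ⥤ ConCat.{w, v, max u w} where
  obj X := M.conCat X.unop
  map f := M.reindex f.unop
  map_id X := M.reindex_id X.unop
  map_comp f g := M.reindex_comp g.unop f.unop

/-- The functor that sends a context over `X` to its underlying object. -/
def underlying (X : D) : (M.conCat X).Ctx ⥤ D where
  obj Γ := CtxOver.obj Γ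
  map f := CtxOver.Hom.map f
  map_id _ := rfl
  map_comp _ _ := rfl

end CwF

/-! ## The local universes construction -/

/-- A category with fibrations: a terminal object exists, and pullbacks of fibrations along
arbitrary maps exist and are fibrations. -/
class CategoryWithFibrations (C : Type u) [Category.{v} C] where
  fib : MorphismProperty C
  [hasTerminal : HasTerminal C]
  [hasPullbacks : fib.HasPullbacks]
  [isStableUnderBaseChange : fib.IsStableUnderBaseChange]

namespace CategoryWithFibrations

attribute [instance] hasTerminal hasPullbacks isStableUnderBaseChange

variable {C : Type u} [Category.{v} C] [CategoryWithFibrations C]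

/-- An object is fibrant if its map to the terminal object is a fibration. -/
def IsFibrant (X : C) : Prop := fib (terminal.from X)

theorem hasPullback' {E V X : C} (r : X ⟶ V) {p : E ⟶ V} (hp : fib p) : HasPullback r p :=
  haveI := MorphismProperty.hasPullback r hp
  hasPullback_symmetry p r

/-- The pullback functor `C/B ⥤ C/A` along a fibration `f : A ⟶ B`. -/
noncomputable def pullbackFunctor {A B : C} (f : A ⟶ B) (hf : fib f) : Over B ⥤ Over A :=
  haveI : HasPullbacksAlong f := fun h => hasPullback' h hf
  Over.pullback f

/-- `Π_f` maps fibrations over `A` to fibrations over `B`. -/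
def PreservesFibrations {A B : C} (Pf : Over A ⥤ Over B) : Prop :=
  ∀ g : Over A, fib g.hom → fib (Pf.obj g).hom

variable (C) in
/-- A local universe: a fibration `p : E ⟶ V`. -/
structure LocalUniverse where
  E : C
  V : C
  p : E ⟶ V
  fib_p : fib p

/-- A type over `X`: a local universe together with a map `r : X ⟶ V`. -/
@[ext]
structure LUType (X : C) extends LocalUniverse C where
  r : X ⟶ V

/-- A term over `X`: a type over `X` together with a section, that is a lift of `r` to `E`. -/
@[ext]
structure LUTerm (X : C) extends LUType X where
  s : X ⟶ E
  s_p : s ≫ p = r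

theorem LUType.hasPullback {X : C} (A : LUType X) : HasPullback A.r A.p :=
  hasPullback' A.r A.fib_p

attribute [local instance] LUType.hasPullback

/-- The lift underlying a term of type `A`. -/
def LUTerm.lift {X : C} (t : LUTerm X) {A : LUType X} (h : t.toLUType = A) : X ⟶ A.E :=
  t.s ≫ eqToHom (congrArg (fun B : LUType X => B.E) h)

theorem LUTerm.lift_p {X : C} (t : LUTerm X) {A : LUType X} (h : t.toLUType = A) :
    t.lift h ≫ A.p = A.r := by
  subst h
  simp [LUTerm.lift, t.s_p]

theorem LUTerm.ext_of_eq {X : C} (t : LUTerm X) (r : X ⟶ t.V) (s : X ⟶ t.E) (h : s ≫ t.p = r)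
    (hr : r = t.r) (hs : s = t.s) : (⟨⟨t.toLocalUniverse, r⟩, s, h⟩ : LUTerm X) = t := by
  subst hr
  subst hs
  rfl

theorem LUTerm.s_injective {X : C} (U : LocalUniverse C) {r r' : X ⟶ U.V} {s s' : X ⟶ U.E}
    {h : s ≫ U.p = r} {h' : s' ≫ U.p = r'}
    (e : (⟨⟨U, r⟩, s, h⟩ : LUTerm X) = ⟨⟨U, r'⟩, s', h'⟩) : s = s' := by
  cases e
  rfl

theorem LUTerm.eq_of_lift {X : C} (t : LUTerm X) {A : LUType X} (h : t.toLUType = A) (s : X ⟶ A.E)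
    (hs : s ≫ A.p = A.r) (h' : s = t.lift h) : (⟨A, s, hs⟩ : LUTerm X) = t := by
  subst h
  obtain rfl : s = t.s := by simpa [LUTerm.lift] using h'
  rfl

variable (C) in
/-- Types, terms and context extensions of the local universes construction. The extension of `X`
by a type `A` is the pullback of `p` along `r`; types and terms are substituted by precomposition
with the universe left unchanged. -/
noncomputable def localUniverses : CwF.{max u v} C where
  Ty := LUType
  Tm := LUTerm
  tp t := t.toLUType
  tySub f A := ⟨A.toLocalUniverse, f ≫ A.r⟩
  tmSub f t := ⟨⟨t.toLocalUniverse, f ≫ t.r⟩, f ≫ t.s, by rw [Category.assoc, t.s_p]⟩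
  tySub_id A := by simp
  tySub_comp g f A := by simp
  tmSub_id t := LUTerm.ext_of_eq t _ _ _ (Category.id_comp _) (Category.id_comp _)
  tmSub_comp g f t := by simp
  tp_tmSub f t := rfl
  ext A := pullback A.r A.p
  proj A := pullback.fst A.r A.p
  var A := ⟨⟨A.toLocalUniverse, pullback.fst A.r A.p ≫ A.r⟩, pullback.snd A.r A.p,
    pullback.condition.symm⟩
  tp_var A := rfl
  pair f A t h := pullback.lift f (t.lift h) (t.lift_p h).symm
  pair_proj f A t h := pullback.lift_fst _ _ _
  var_pair f A t h := by
    have e : pullback.lift f (t.lift h) (t.lift_p h).symm ≫ pullback.fst A.r A.p ≫ A.r =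
        f ≫ A.r := by
      rw [pullback.lift_fst_assoc]
    refine LUTerm.eq_of_lift t (h.trans (congrArg (LUType.mk A.toLocalUniverse) e.symm)) _ _ ?_
    exact (pullback.lift_snd _ _ _)
  hom_ext g g' h₁ h₂ := by
    exact pullback.hom_ext h₁ (LUTerm.s_injective _ h₂)

end CategoryWithFibrations

open CategoryWithFibrations

/-- The contextual category `C_!` of a category with fibrations `C`. -/
noncomputable def shriek (C : Type u) [Category.{v} C] [CategoryWithFibrations C] :
    ConCat.{max u v, v, max u v} :=
  (localUniverses C).conCat (⊤_ C)

/-- The functor from the category of contexts of `C_!` to `C`. -/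
noncomputable def shriekFunctor (C : Type u) [Category.{v} C] [CategoryWithFibrations C] :
    (shriek C).Ctx ⥤ C :=
  (localUniverses C).underlying (⊤_ C)

/-- For a functor `G` from the category of contexts of a contextual category to a category with
fibrations `C`, the contextually indexed contextual category `G^*(C_!)`: closed types in a context
`Γ` are diagrams `G(Γ) ⟶ V ⟵ E` with `E ⟶ V` a fibration, and contexts, terms and non-closed types
are defined as in `C_!` with `G(Γ)` in place of the terminal object. -/
noncomputable def changeOfBase (B : ConCat.{w₁, v₁, u₁}) {C : Type u₂} [Category.{v₂} C]
    [CategoryWithFibrations C] (G : B.Ctx ⥤ C) : IndexedConCat where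
  base := B
  fiber := G.op ⋙ (localUniverses C).conCatFunctor

/-- For a functor `F : B ⥤ C` between categories with fibrations, the contextually indexed
contextual category `F^*(C_!)`, indexed over `B_!`. -/
noncomputable def pullbackShriek {B : Type u₁} [Category.{v₁} B] [CategoryWithFibrations B]
    {C : Type u₂} [Category.{v₂} C] [CategoryWithFibrations C] (F : B ⥤ C) : IndexedConCat :=
  changeOfBase (shriek B) (shriekFunctor B ⋙ F)

end IndexedTT

open IndexedTT IndexedTT.CategoryWithFibrations

namespace IndexedTT

theorem CwF.lift_eq_eqToHom {D : Type u} [Category.{v} D] (M : CwF.{w} D) {X : D}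
    {Γ : M.CtxOver X} {Z : D} (s : Γ.obj ⟶ Z) (A : M.Ty Z) (A' : M.Ty Γ.obj)
    (h : A' = M.tySub s A) (h' : M.extObj Γ A' = M.extObj Γ (M.tySub s A)) :
    M.lift s A A' h = (eqToHom h').map ≫ M.lift s A _ rfl := by
  subst h
  exact (Category.id_comp _).symm

theorem CwF.tySub_inst_var_lift {D : Type u} [Category.{v} D] (M : CwF.{w} D) {X : D}
    (A : M.Ty X) (B : M.Ty (M.ext A)) :
    M.tySub (M.inst (M.tySub (M.proj A) A) (M.var A) (M.tp_var A))
      (M.tySub (M.lift (M.proj A) A _ rfl) B) = B := by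
  rw [← M.tySub_comp]
  refine Eq.trans ?_ (M.tySub_id B)
  congr 1
  apply M.hom_ext
  · rw [Category.assoc, M.lift_proj, ← Category.assoc, M.inst_proj, Category.id_comp]
  · rw [M.tmSub_comp, M.var_lift, M.tmSub_id]
    exact M.var_pair _ _ _ _

namespace CategoryWithFibrations

variable {C : Type u} [Category.{v} C] [CategoryWithFibrations C]

/-! ## Dependent products by generalized elements -/

section DependentProduct

variable {X Y : C} {f : X ⟶ Y} {hf : fib f} {R : Over X ⥤ Over Y}
  (adj : pullbackFunctor f hf ⊣ R) (g : Over X)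

/-- The counit of the adjunction between pullback along `f` and `Π_f`, as a map out of a
pullback. -/
noncomputable def piCounit :
    @pullback _ _ _ _ _ (R.obj g).hom f (hasPullback' _ hf) ⟶ g.left :=
  (adj.counit.app g).left

theorem piCounit_hom :
    piCounit adj g ≫ g.hom = @pullback.snd _ _ _ _ _ (R.obj g).hom f (hasPullback' _ hf) :=
  Over.w (adj.counit.app g)

/-- Evaluation of a generalized element of `Π_f g` at a generalized element of the domain. -/
noncomputable def piEval {Q : C} (k : Q ⟶ (R.obj g).left) (e : Q ⟶ X)
    (h : k ≫ (R.obj g).hom = e ≫ f) : Q ⟶ g.left :=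
  haveI : HasPullback (R.obj g).hom f := hasPullback' _ hf
  pullback.lift k e h ≫ piCounit adj g

theorem piEval_congr {Q : C} {k k' : Q ⟶ (R.obj g).left} {e e' : Q ⟶ X} (hk : k = k')
    (he : e = e') (h : k ≫ (R.obj g).hom = e ≫ f) :
    piEval adj g k e h = piEval adj g k' e' (by rw [← hk, ← he, h]) := by
  subst hk he
  rfl

theorem piEval_hom {Q : C} (k : Q ⟶ (R.obj g).left) (e : Q ⟶ X)
    (h : k ≫ (R.obj g).hom = e ≫ f) : piEval adj g k e h ≫ g.hom = e := by
  have : HasPullback (R.obj g).hom f := hasPullback' _ hf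
  rw [piEval, Category.assoc, piCounit_hom, pullback.lift_snd]

theorem comp_piEval {Q Q' : C} (m : Q' ⟶ Q) (k : Q ⟶ (R.obj g).left) (e : Q ⟶ X)
    (h : k ≫ (R.obj g).hom = e ≫ f) :
    m ≫ piEval adj g k e h = piEval adj g (m ≫ k) (m ≫ e) (by simp [h]) := by
  have : HasPullback (R.obj g).hom f := hasPullback' _ hf
  unfold piEval
  rw [← Category.assoc m]
  congr 1
  apply pullback.hom_ext <;> simp only [Category.assoc, pullback.lift_fst, pullback.lift_snd]

theorem homEquiv_symm_left {Z : C} {x : Z ⟶ Y} (k : Over.mk x ⟶ R.obj g) :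
    ((adj.homEquiv _ _).symm k).left =
      haveI : HasPullback x f := hasPullback' _ hf
      piEval adj g (pullback.fst x f ≫ k.left) (pullback.snd x f)
        (by
          have h : k.left ≫ (R.obj g).hom = x := Over.w k
          rw [Category.assoc, h, pullback.condition]) := by
  rw [Adjunction.homEquiv_counit]
  rfl

/-- Generalized elements of `Π_f g` over `x` are the same as maps over `X` from the pullback of
`x` along `f` to `g`. -/
theorem existsUnique_piEval {Z Q : C} {q : Q ⟶ Z} {e : Q ⟶ X} {x : Z ⟶ Y}
    (sq : IsPullback q e x f) (h : Q ⟶ g.left) (hh : h ≫ g.hom = e) :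
    ∃! k : Z ⟶ (R.obj g).left, ∃ hk : k ≫ (R.obj g).hom = x,
      piEval adj g (q ≫ k) e (by rw [Category.assoc, hk, sq.w]) = h := by
  have : HasPullback x f := hasPullback' _ hf
  let sq' : IsPullback (pullback.fst x f) (pullback.snd x f) x f := IsPullback.of_hasPullback x f
  let i : Q ≅ pullback x f := sq.isoIsPullback _ _ sq'
  have i₁ : i.hom ≫ pullback.fst x f = q := sq.isoIsPullback_hom_fst _ _ sq'
  have i₂ : i.hom ≫ pullback.snd x f = e := sq.isoIsPullback_hom_snd _ _ sq'
  have key : ∀ (k : Over.mk x ⟶ R.obj g) (hk : k.left ≫ (R.obj g).hom = x),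
      piEval adj g (q ≫ k.left) e (by rw [Category.assoc, hk, sq.w]) =
        i.hom ≫ ((adj.homEquiv _ _).symm k).left := by
    intro k hk
    rw [homEquiv_symm_left]
    refine Eq.trans ?_ (comp_piEval adj g i.hom _ _ _).symm
    exact piEval_congr adj g (by rw [← Category.assoc i.hom, i₁]) i₂.symm _
  have hw : (i.inv ≫ h) ≫ g.hom = pullback.snd x f := by
    rw [Category.assoc, hh, Iso.inv_comp_eq, i₂]
  let h' : (pullbackFunctor f hf).obj (Over.mk x) ⟶ g := Over.homMk (i.inv ≫ h) hw
  refine ⟨(adj.homEquiv _ _ h').left, ⟨Over.w (adj.homEquiv _ _ h'), ?_⟩, ?_⟩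
  · rw [key _ (Over.w (adj.homEquiv _ _ h')), Equiv.symm_apply_apply]
    exact Iso.hom_inv_id_assoc _ _
  · rintro k ⟨hk, hk'⟩
    let k' : Over.mk x ⟶ R.obj g := Over.homMk k hk
    have e' : (adj.homEquiv _ _).symm k' = h' := by
      apply Over.OverMorphism.ext
      exact (Iso.eq_inv_comp i).mpr ((key k' hk).symm.trans hk')
    rw [← e', Equiv.apply_symm_apply]
    rfl

end DependentProduct

/-! ## Universes of dependent products -/

/-- A family over `V` of maps from fibres of `U` to the base of `W`, by generalized elements. -/
structure FamilyObject (U W : LocalUniverse C) where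
  V : C
  base : V ⟶ U.V
  fam : ∀ {Q : C} (v : Q ⟶ V) (e : Q ⟶ U.E), v ≫ base = e ≫ U.p → (Q ⟶ W.V)
  comp_fam : ∀ {Q Q' : C} (m : Q' ⟶ Q) (v : Q ⟶ V) (e : Q ⟶ U.E) (h : v ≫ base = e ≫ U.p),
    m ≫ fam v e h = fam (m ≫ v) (m ≫ e) (by rw [Category.assoc, h, Category.assoc])

namespace FamilyObject

variable {U W : LocalUniverse C}

/-- The family is the universal one: it classifies maps from pullbacks of `U` to the base of
`W`. -/
def IsUniversal (K : FamilyObject U W) : Prop :=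
  ∀ {X Q : C} {q : Q ⟶ X} {e : Q ⟶ U.E} {x : X ⟶ U.V} (sq : IsPullback q e x U.p) (b : Q ⟶ W.V),
    ∃! r : X ⟶ K.V, ∃ hr : r ≫ K.base = x,
      K.fam (q ≫ r) e (by rw [Category.assoc, hr, sq.w]) = b

/-- The restriction of a family along a map. -/
def restrict (K : FamilyObject U W) {V' : C} (ε : V' ⟶ K.V) : FamilyObject U W where
  V := V'
  base := ε ≫ K.base
  fam v e h := K.fam (v ≫ ε) e (by rw [Category.assoc, h])
  comp_fam m v e h := by
    rw [K.comp_fam]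
    simp only [Category.assoc]

theorem fam_congr (K : FamilyObject U W) {Q : C} {v v' : Q ⟶ K.V} {e e' : Q ⟶ U.E}
    (hv : v = v') (he : e = e') (h : v ≫ K.base = e ≫ U.p) :
    K.fam v e h = K.fam v' e' (by rw [← hv, ← he, h]) := by
  subst hv he
  rfl

/-- The family given by the dependent product of `U.E ⨯ W.V` along `U.p`. -/
noncomputable def ofAdjunction [HasBinaryProducts C] {R : Over U.E ⥤ Over U.V}
    (adj : pullbackFunctor U.p U.fib_p ⊣ R) : FamilyObject U W where
  V := (R.obj (Over.mk (prod.fst : U.E ⨯ W.V ⟶ U.E))).left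
  base := (R.obj (Over.mk (prod.fst : U.E ⨯ W.V ⟶ U.E))).hom
  fam v e h := piEval adj _ v e h ≫ prod.snd
  comp_fam m v e h := by rw [← Category.assoc, comp_piEval]

theorem isUniversal_ofAdjunction [HasBinaryProducts C] {R : Over U.E ⥤ Over U.V}
    (adj : pullbackFunctor U.p U.fib_p ⊣ R) :
    (ofAdjunction adj : FamilyObject U W).IsUniversal := by
  intro X Q q e x sq b
  obtain ⟨k, ⟨hk, hk'⟩, hu⟩ := existsUnique_piEval adj (Over.mk (prod.fst : U.E ⨯ W.V ⟶ U.E)) sq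
    (prod.lift e b) (prod.lift_fst _ _)
  refine ⟨k, ⟨hk, ?_⟩, ?_⟩
  · exact (congrArg (· ≫ prod.snd) hk').trans (prod.lift_snd _ _)
  · rintro k' ⟨h₁, h₂⟩
    refine hu k' ⟨h₁, ?_⟩
    apply Limits.prod.hom_ext
    · exact (piEval_hom adj _ _ _ _).trans (prod.lift_fst _ _).symm
    · exact h₂.trans (prod.lift_snd _ _).symm

end FamilyObject

/-- A fibration over `K.V` that classifies the dependent sections of the family `K`. -/
structure SectionUniverse {U W : LocalUniverse C} (K : FamilyObject U W) where
  E : C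
  p : E ⟶ K.V
  fib_p : fib p
  eval : ∀ {Q : C} (k : Q ⟶ E) (e : Q ⟶ U.E), (k ≫ p) ≫ K.base = e ≫ U.p → (Q ⟶ W.E)
  eval_p : ∀ {Q : C} (k : Q ⟶ E) (e : Q ⟶ U.E) (h : (k ≫ p) ≫ K.base = e ≫ U.p),
    eval k e h ≫ W.p = K.fam (k ≫ p) e h
  comp_eval : ∀ {Q Q' : C} (m : Q' ⟶ Q) (k : Q ⟶ E) (e : Q ⟶ U.E)
    (h : (k ≫ p) ≫ K.base = e ≫ U.p),
    m ≫ eval k e h = eval (m ≫ k) (m ≫ e) (by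
      rw [Category.assoc, Category.assoc, ← Category.assoc k, h, Category.assoc])
  existsUnique_eval : ∀ {X Q : C} {q : Q ⟶ X} {e : Q ⟶ U.E} {r : X ⟶ K.V}
    (sq : IsPullback q e (r ≫ K.base) U.p) (b : Q ⟶ W.E)
    (_ : b ≫ W.p = K.fam (q ≫ r) e (by rw [Category.assoc, sq.w])),
    ∃! k : X ⟶ E, ∃ hk : k ≫ p = r,
      eval (q ≫ k) e (by rw [Category.assoc q, hk, Category.assoc, sq.w]) = b

namespace SectionUniverse

variable {U W : LocalUniverse C} {K : FamilyObject U W}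

theorem eval_congr (S : SectionUniverse K) {Q : C} {k k' : Q ⟶ S.E} {e e' : Q ⟶ U.E}
    (hk : k = k') (he : e = e') (h : (k ≫ S.p) ≫ K.base = e ≫ U.p) :
    S.eval k e h = S.eval k' e' (by rw [← hk, ← he, h]) := by
  subst hk he
  rfl

theorem nonempty_of_adjunction (K : FamilyObject U W)
    (Pf : ∀ {X : C} (f : X ⟶ K.V), fib f → (Over X ⥤ Over K.V))
    (adj : ∀ {X : C} (f : X ⟶ K.V) (hf : fib f), pullbackFunctor f hf ⊣ Pf f hf)
    (hPf : ∀ {X : C} (f : X ⟶ K.V) (hf : fib f), PreservesFibrations (Pf f hf)) :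
    Nonempty (SectionUniverse K) := by
  have : HasPullback K.base U.p := hasPullback' _ U.fib_p
  have hf : fib (pullback.fst K.base U.p) :=
    MorphismProperty.of_isPullback (IsPullback.of_hasPullback K.base U.p).flip U.fib_p
  let c : pullback K.base U.p ⟶ W.V :=
    K.fam (pullback.fst _ _) (pullback.snd _ _) pullback.condition
  have hc : ∀ {Q : C} (v : Q ⟶ K.V) (e : Q ⟶ U.E) (h : v ≫ K.base = e ≫ U.p),
      pullback.lift v e h ≫ c = K.fam v e h := fun v e h =>
    (K.comp_fam _ _ _ _).trans
      (K.fam_congr (pullback.lift_fst _ _ _) (pullback.lift_snd _ _ _) _)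
  have : HasPullback c W.p := hasPullback' _ W.fib_p
  let g : Over (pullback K.base U.p) := Over.mk (pullback.fst c W.p)
  have hg : fib g.hom := MorphismProperty.of_isPullback (IsPullback.of_hasPullback c W.p).flip W.fib_p
  let P := (Pf _ hf).obj g
  have hl : ∀ {Q : C} (k : Q ⟶ P.left) (e : Q ⟶ U.E) (h : (k ≫ P.hom) ≫ K.base = e ≫ U.p),
      k ≫ P.hom = pullback.lift (k ≫ P.hom) e h ≫ pullback.fst K.base U.p := fun k e h =>
    (pullback.lift_fst _ _ _).symm
  refine ⟨⟨P.left, P.hom, hPf _ hf g hg,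
    fun k e h => piEval (adj _ hf) g k (pullback.lift (k ≫ P.hom) e h) (hl k e h) ≫
      pullback.snd c W.p, ?_, ?_, ?_⟩⟩
  · intro Q k e h
    have := piEval_hom (adj _ hf) g k (pullback.lift (k ≫ P.hom) e h) (hl k e h)
    rw [Category.assoc, ← pullback.condition, ← hc, ← Category.assoc]
    exact congrArg (· ≫ c) this
  · intro Q Q' m k e h
    rw [← Category.assoc, comp_piEval]
    refine congrArg (· ≫ pullback.snd c W.p) (piEval_congr _ g rfl ?_ _)
    apply pullback.hom_ext <;> simp only [Category.assoc, pullback.lift_fst, pullback.lift_snd]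
  · intro X Q q e r sq b hb
    have h₀ : (q ≫ r) ≫ K.base = e ≫ U.p := by rw [Category.assoc, sq.w]
    have sq' : IsPullback q (pullback.lift (q ≫ r) e h₀) r (pullback.fst K.base U.p) := by
      refine (IsPullback.of_right ?_ (pullback.lift_fst _ _ _)
        (IsPullback.of_hasPullback K.base U.p).flip).flip
      rwa [pullback.lift_snd, IsPullback.flip_iff]
    have hlift : ∀ (k : X ⟶ P.left) (h : ((q ≫ k) ≫ P.hom) ≫ K.base = e ≫ U.p)
        (h' : (q ≫ k ≫ P.hom) ≫ K.base = e ≫ U.p),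
        pullback.lift ((q ≫ k) ≫ P.hom) e h = pullback.lift (q ≫ k ≫ P.hom) e h' := by
      intro k h h'
      apply pullback.hom_ext <;> simp only [Category.assoc, pullback.lift_fst, pullback.lift_snd]
    obtain ⟨k, ⟨hk, hk'⟩, hu⟩ := existsUnique_piEval (adj _ hf) g sq'
      (pullback.lift (pullback.lift (q ≫ r) e h₀) b (by rw [hc, hb])) (pullback.lift_fst _ _ _)
    refine ⟨k, ⟨hk, ?_⟩, ?_⟩
    · subst hk
      refine Eq.trans ?_ ((congrArg (· ≫ pullback.snd c W.p) hk').trans (pullback.lift_snd _ _ _))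
      exact congrArg (· ≫ pullback.snd c W.p) (piEval_congr _ g rfl (hlift _ _ _) _)
    · rintro k' ⟨rfl, h₂⟩
      refine hu k' ⟨rfl, ?_⟩
      apply pullback.hom_ext
      · exact (piEval_hom (adj _ hf) g _ _ _).trans (pullback.lift_fst _ _ _).symm
      · refine Eq.trans ?_ (h₂.trans (pullback.lift_snd _ _ _).symm)
        exact congrArg (· ≫ pullback.snd c W.p) (piEval_congr _ g rfl (hlift _ _ _).symm _)

end SectionUniverse

/-! ## Codes for dependent products in the local universes construction -/

attribute [local instance] LUType.hasPullback

theorem LUTerm.lift_self {X : C} (t : LUTerm X) (h : t.toLUType = t.toLUType) :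
    t.lift h = t.s := by
  simp [LUTerm.lift]

theorem LUTerm.lift_tmSub {X Y : C} (s : Y ⟶ X) (t : LUTerm X) {A : LUType X}
    (h : t.toLUType = A) (h' : ((localUniverses C).tmSub s t).toLUType =
      (localUniverses C).tySub s A) :
    ((localUniverses C).tmSub s t).lift h' = s ≫ t.lift h := by
  subst h
  exact (LUTerm.lift_self _ _).trans (congrArg (s ≫ ·) (LUTerm.lift_self _ _).symm)

theorem lift_fst {X Y : C} (s : Y ⟶ X) (A : LUType X) :
    (localUniverses C).lift s A _ rfl ≫ pullback.fst A.r A.p = 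
      (localUniverses C).proj ((localUniverses C).tySub s A) ≫ s :=
  (localUniverses C).lift_proj s A _ rfl

theorem lift_snd {X Y : C} (s : Y ⟶ X) (A : LUType X) :
    (localUniverses C).lift s A _ rfl ≫ pullback.snd A.r A.p = 
      @pullback.snd _ _ _ _ _ (s ≫ A.r) A.p (hasPullback' _ A.fib_p) :=
  LUTerm.s_injective _ ((localUniverses C).var_lift s A _ rfl)

theorem inst_fst {X : C} (A : LUType X) (a : LUTerm X) (ha : a.toLUType = A) :
    (localUniverses C).inst A a ha ≫ pullback.fst A.r A.p = 𝟙 X :=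
  (localUniverses C).inst_proj A a ha

theorem inst_snd {X : C} (A : LUType X) (a : LUTerm X) (ha : a.toLUType = A) :
    (localUniverses C).inst A a ha ≫ pullback.snd A.r A.p = a.lift ha := by
  subst ha
  exact (LUTerm.s_injective _ (((localUniverses C).var_pair (𝟙 X) _ a
    ((localUniverses C).tySub_id _).symm))).trans (LUTerm.lift_self _ _).symm

theorem LUType.r_injective {X : C} (U : LocalUniverse C) {r r' : X ⟶ U.V}
    (h : (⟨U, r⟩ : LUType X) = ⟨U, r'⟩) : r = r' := by
  cases h
  rfl

theorem LUTerm.mk_congr {X : C} (U : LocalUniverse C) {r r' : X ⟶ U.V} {s s' : X ⟶ U.E}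
    (h : s ≫ U.p = r) (h' : s' ≫ U.p = r') (hs : s = s') :
    (⟨⟨U, r⟩, s, h⟩ : LUTerm X) = ⟨⟨U, r'⟩, s', h'⟩ := by
  subst hs h h'
  rfl

theorem LUTerm.lift_mk {X : C} {U : LocalUniverse C} {r r' : X ⟶ U.V} {s : X ⟶ U.E}
    {h : s ≫ U.p = r} (h' : (⟨⟨U, r⟩, s, h⟩ : LUTerm X).toLUType = ⟨U, r'⟩) :
    LUTerm.lift (A := ⟨U, r'⟩) ⟨⟨U, r⟩, s, h⟩ h' = s :=
  Category.comp_id s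

section Codes

variable (K : ∀ U W : LocalUniverse C, FamilyObject U W)

/-- The map `r` is a code for the family of types `B` depending on a variable of type `A`. -/
structure Classifies {X : C} (A : LUType X) (B : LUType (pullback A.r A.p))
    (r : X ⟶ (K A.toLocalUniverse B.toLocalUniverse).V) : Prop where
  base : r ≫ (K _ _).base = A.r
  fam : (K _ _).fam (pullback.fst A.r A.p ≫ r) (pullback.snd A.r A.p)
    (by rw [Category.assoc, base, pullback.condition]) = B.r

variable {K}

theorem Classifies.sub {X Y : C} {A : LUType X} {B : LUType (pullback A.r A.p)}
    {r : X ⟶ (K A.toLocalUniverse B.toLocalUniverse).V} (hr : Classifies K A B r) (s : Y ⟶ X) :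
    Classifies K ((localUniverses C).tySub s A)
      ((localUniverses C).tySub ((localUniverses C).lift s A _ rfl) B) (s ≫ r) where
  base := (Category.assoc _ _ _).trans (congrArg (s ≫ ·) hr.base)
  fam := by
    refine Eq.trans ?_ (congrArg ((localUniverses C).lift s A _ rfl ≫ ·) hr.fam)
    refine Eq.trans ?_ ((K _ _).comp_fam _ _ _ _).symm
    refine (K _ _).fam_congr ?_ (lift_snd s A).symm _
    exact (Category.assoc _ _ _).symm.trans
      ((congrArg (· ≫ r) (lift_fst s A).symm).trans (Category.assoc _ _ _))

/-- The code of a family of types in a universal family. -/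
theorem existsUnique_classifies (hK : ∀ U W, (K U W).IsUniversal) {X : C} (A : LUType X)
    (B : LUType (pullback A.r A.p)) : ∃! r, Classifies K A B r := by
  obtain ⟨r, ⟨hr, hr'⟩, hu⟩ := hK _ _ (IsPullback.of_hasPullback A.r A.p) B.r
  exact ⟨r, ⟨hr, hr'⟩, fun r' h => hu r' ⟨h.base, h.fam⟩⟩

variable (S : ∀ U W : LocalUniverse C, SectionUniverse (K U W))

/-- The local universe of dependent products. -/
def SectionUniverse.toLocalUniverse {U W : LocalUniverse C} {K : FamilyObject U W}
    (S : SectionUniverse K) : LocalUniverse C :=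
  ⟨S.E, K.V, S.p, S.fib_p⟩

/-- The dependent product with a given code. -/
def piType {X : C} {A : LUType X} {B : LUType (pullback A.r A.p)}
    (r : X ⟶ (K A.toLocalUniverse B.toLocalUniverse).V) : LUType X :=
  ⟨(S A.toLocalUniverse B.toLocalUniverse).toLocalUniverse, r⟩

section Terms

variable {X : C} {A : LUType X} {B : LUType (pullback A.r A.p)}
  {r : X ⟶ (K A.toLocalUniverse B.toLocalUniverse).V} (hr : Classifies K A B r)

theorem existsUnique_lam (b : LUTerm (pullback A.r A.p)) (hb : b.toLUType = B) :
    ∃! k : X ⟶ (S A.toLocalUniverse B.toLocalUniverse).E, ∃ hk : k ≫ (S _ _).p = r,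
      (S _ _).eval (pullback.fst A.r A.p ≫ k) (pullback.snd A.r A.p)
        (by rw [Category.assoc (pullback.fst A.r A.p), hk, Category.assoc, hr.base,
          pullback.condition]) = b.lift hb :=
  (S _ _).existsUnique_eval (by rw [hr.base]; exact IsPullback.of_hasPullback A.r A.p) _
    ((b.lift_p hb).trans hr.fam.symm)

/-- The map underlying an abstraction. -/
noncomputable def lamMap (b : LUTerm (pullback A.r A.p)) (hb : b.toLUType = B) :
    X ⟶ (S A.toLocalUniverse B.toLocalUniverse).E :=
  (existsUnique_lam S hr b hb).choose

theorem lamMap_p (b : LUTerm (pullback A.r A.p)) (hb : b.toLUType = B) :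
    lamMap S hr b hb ≫ (S _ _).p = r :=
  (existsUnique_lam S hr b hb).choose_spec.1.1

theorem eval_lamMap (b : LUTerm (pullback A.r A.p)) (hb : b.toLUType = B) :
    (S _ _).eval (pullback.fst A.r A.p ≫ lamMap S hr b hb) (pullback.snd A.r A.p)
      (by rw [Category.assoc (pullback.fst A.r A.p), lamMap_p, Category.assoc, hr.base,
        pullback.condition]) = b.lift hb :=
  (existsUnique_lam S hr b hb).choose_spec.1.2

theorem eq_lamMap (b : LUTerm (pullback A.r A.p)) (hb : b.toLUType = B)
    (k : X ⟶ (S A.toLocalUniverse B.toLocalUniverse).E) (hk : k ≫ (S _ _).p = r)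
    (h : (S _ _).eval (pullback.fst A.r A.p ≫ k) (pullback.snd A.r A.p)
        (by rw [Category.assoc (pullback.fst A.r A.p), hk, Category.assoc, hr.base,
          pullback.condition]) = b.lift hb) :
    k = lamMap S hr b hb :=
  (existsUnique_lam S hr b hb).choose_spec.2 k ⟨hk, h⟩

/-- Abstraction of a term. -/
noncomputable def lamTerm (b : LUTerm (pullback A.r A.p)) (hb : b.toLUType = B) : LUTerm X :=
  ⟨piType S r, lamMap S hr b hb, lamMap_p S hr b hb⟩

/-- The map underlying a term of a dependent product. -/
def piLift (f : LUTerm X) (hf : f.toLUType = piType S r) :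
    X ⟶ (S A.toLocalUniverse B.toLocalUniverse).E :=
  f.lift hf

theorem piLift_p (f : LUTerm X) (hf : f.toLUType = piType S r) :
    piLift S f hf ≫ (S _ _).p = r :=
  f.lift_p hf

include hr in
theorem piLift_base (f a : LUTerm X) (hf : f.toLUType = piType S r) (ha : a.toLUType = A) :
    (piLift S f hf ≫ (S _ _).p) ≫ (K _ _).base = a.lift ha ≫ A.p := by
  rw [a.lift_p, piLift_p, hr.base]

include hr in
theorem Classifies.inst_fam (a : LUTerm X) (ha : a.toLUType = A)
    (h : r ≫ (K _ _).base = a.lift ha ≫ A.p) :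
    (K _ _).fam r (a.lift ha) h = (localUniverses C).inst A a ha ≫ B.r := by
  rw [← hr.fam]
  refine Eq.trans ?_ ((K _ _).comp_fam ((localUniverses C).inst A a ha) _ _ _).symm
  refine (K _ _).fam_congr ?_ (inst_snd A a ha).symm _
  exact (Category.id_comp r).symm.trans
    ((congrArg (· ≫ r) (inst_fst A a ha).symm).trans (Category.assoc _ _ _))

/-- Application of a term of a dependent product. -/
noncomputable def appTerm (f a : LUTerm X) (hf : f.toLUType = piType S r) (ha : a.toLUType = A) : LUTerm X :=
  ⟨(localUniverses C).tySub ((localUniverses C).inst A a ha) B,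
    (S _ _).eval (piLift S f hf) (a.lift ha) (piLift_base S hr f a hf ha), by
      refine ((S _ _).eval_p _ _ _).trans (Eq.trans ?_ (hr.inst_fam a ha
        (by rw [hr.base, a.lift_p])))
      exact (K _ _).fam_congr (piLift_p S f hf) rfl _⟩

theorem beta_appTerm (b : LUTerm (pullback A.r A.p)) (hb : b.toLUType = B) (a : LUTerm X)
    (hf : (lamTerm S hr b hb).toLUType = piType S r) (ha : a.toLUType = A) :
    appTerm S hr (lamTerm S hr b hb) a hf ha =
      (localUniverses C).tmSub ((localUniverses C).inst A a ha) b := by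
  subst hb
  refine LUTerm.mk_congr _ _ _ ?_
  refine Eq.trans ?_ (congrArg ((localUniverses C).inst A a ha ≫ ·)
    ((eval_lamMap S hr b rfl).trans (LUTerm.lift_self _ _)))
  refine Eq.trans ?_ ((S _ _).comp_eval _ _ _ _).symm
  refine (S _ _).eval_congr ?_ (inst_snd A a ha).symm _
  refine (LUTerm.lift_self _ _).trans ?_
  exact (Category.id_comp _).symm.trans
    ((congrArg (· ≫ lamMap S hr b rfl) (inst_fst A a ha).symm).trans (Category.assoc _ _ _))

end Terms

section Substitution

variable {X Y : C} {A : LUType X} {B : LUType (pullback A.r A.p)}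
  {r : X ⟶ (K A.toLocalUniverse B.toLocalUniverse).V} (hr : Classifies K A B r) (s : Y ⟶ X)
  {A' : LUType Y} {B' : LUType (pullback A'.r A'.p)}
  {r' : Y ⟶ (K A'.toLocalUniverse B'.toLocalUniverse).V} (hr' : Classifies K A' B' r')
  (hA : A' = (localUniverses C).tySub s A)
  (hB : B' = (localUniverses C).tySub ((localUniverses C).lift s A A' hA) B)
  (hP : piType S r' = (localUniverses C).tySub s (piType S r))

include hB hP in
theorem tmSub_lamTerm (b : LUTerm (pullback A.r A.p)) (hb : b.toLUType = B)
    (b' : LUTerm (pullback A'.r A'.p)) (hb' : b'.toLUType = B')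
    (h : b' = (localUniverses C).tmSub ((localUniverses C).lift s A A' hA) b) :
    (localUniverses C).tmSub s (lamTerm S hr b hb) = lamTerm S hr' b' hb' := by
  subst hA hB h
  obtain rfl : r' = s ≫ r := LUType.r_injective _ hP
  subst hb
  refine LUTerm.mk_congr _ _ _ (eq_lamMap S hr' _ hb' (s ≫ lamMap S hr b rfl) ?_ ?_)
  · exact (Category.assoc _ _ _).trans (congrArg (s ≫ ·) (lamMap_p S hr b rfl))
  · refine Eq.trans ?_ ((congrArg ((localUniverses C).lift s A _ rfl ≫ ·)
      ((eval_lamMap S hr b rfl).trans (LUTerm.lift_self _ _))).trans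
        (LUTerm.lift_self ((localUniverses C).tmSub ((localUniverses C).lift s A _ rfl) b) rfl).symm)
    refine Eq.trans ?_ ((S _ _).comp_eval _ _ _ _).symm
    refine (S _ _).eval_congr ?_ (lift_snd s A).symm _
    exact (Category.assoc _ _ _).symm.trans
      ((congrArg (· ≫ lamMap S hr b rfl) (lift_fst s A).symm).trans (Category.assoc _ _ _))

include hB hP in
theorem tmSub_appTerm (f a : LUTerm X) (hf : f.toLUType = piType S r) (ha : a.toLUType = A)
    (f' a' : LUTerm Y) (hf' : f'.toLUType = piType S r') (ha' : a'.toLUType = A')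
    (h₁ : f' = (localUniverses C).tmSub s f) (h₂ : a' = (localUniverses C).tmSub s a) :
    (localUniverses C).tmSub s (appTerm S hr f a hf ha) = appTerm S hr' f' a' hf' ha' := by
  subst hA hB h₁ h₂
  obtain rfl : r' = s ≫ r := LUType.r_injective _ hP
  refine LUTerm.mk_congr _ _ _ (((S _ _).comp_eval _ _ _ _).trans ?_)
  exact (S _ _).eval_congr (LUTerm.lift_tmSub s f hf hf').symm
    (LUTerm.lift_tmSub s a ha ha').symm _

end Substitution

theorem eta_lamTerm {X : C} {A : LUType X} {B : LUType (pullback A.r A.p)}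
    {r : X ⟶ (K A.toLocalUniverse B.toLocalUniverse).V} (hr : Classifies K A B r)
    (f : LUTerm X) (hf : f.toLUType = piType S r)
    {A' : LUType (pullback A.r A.p)} {B' : LUType (pullback A'.r A'.p)}
    {r' : pullback A.r A.p ⟶ (K A'.toLocalUniverse B'.toLocalUniverse).V}
    (hr' : Classifies K A' B' r') (hA : A' = (localUniverses C).tySub ((localUniverses C).proj A) A)
    (hB : B' = (localUniverses C).tySub
      ((localUniverses C).lift ((localUniverses C).proj A) A A' hA) B)
    (hP : piType S r' = (localUniverses C).tySub ((localUniverses C).proj A) (piType S r))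
    (f' : LUTerm (pullback A.r A.p)) (hf' : f'.toLUType = piType S r')
    (h : f' = (localUniverses C).tmSub ((localUniverses C).proj A) f)
    (ha' : ((localUniverses C).var A).toLUType = A')
    (hb : (appTerm S hr' f' ((localUniverses C).var A) hf' ha').toLUType = B) :
    lamTerm S hr (appTerm S hr' f' ((localUniverses C).var A) hf' ha') hb = f := by
  subst hA hB h
  obtain rfl : r' = (localUniverses C).proj A ≫ r := LUType.r_injective _ hP
  refine LUTerm.eq_of_lift f hf _ _ (eq_lamMap S hr _ hb (piLift S f hf) (piLift_p S f hf) ?_).symm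
  refine Eq.trans ?_ (LUTerm.lift_mk hb).symm
  exact (S _ _).eval_congr (LUTerm.lift_tmSub _ f hf hf').symm
    (LUTerm.lift_self ((localUniverses C).var A) rfl).symm _

end Codes

section PiTypes

variable {K : ∀ U W : LocalUniverse C, FamilyObject U W} (hK : ∀ U W, (K U W).IsUniversal)

/-- The code of a family of types in a universal family. -/
noncomputable def code {X : C} (A : LUType X) (B : LUType (pullback A.r A.p)) :
    X ⟶ (K A.toLocalUniverse B.toLocalUniverse).V :=
  (existsUnique_classifies hK A B).choose

theorem classifies_code {X : C} (A : LUType X) (B : LUType (pullback A.r A.p)) :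
    Classifies K A B (code hK A B) :=
  (existsUnique_classifies hK A B).choose_spec.1

theorem comp_code {X Y : C} (s : Y ⟶ X) (A : LUType X) (B : LUType (pullback A.r A.p)) :
    s ≫ code hK A B = code hK ((localUniverses C).tySub s A)
      ((localUniverses C).tySub ((localUniverses C).lift s A _ rfl) B) :=
  (existsUnique_classifies hK _ _).choose_spec.2 _ ((classifies_code hK A B).sub s)

variable (S : ∀ U W : LocalUniverse C, SectionUniverse (K U W))

theorem piType_code_sub {X Y : C} (s : Y ⟶ X) (A : LUType X) (B : LUType (pullback A.r A.p)) :
    piType S (code hK ((localUniverses C).tySub s A)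
      ((localUniverses C).tySub ((localUniverses C).lift s A _ rfl) B)) =
    (localUniverses C).tySub s (piType S (code hK A B)) :=
  congrArg (LUType.mk _) (comp_code hK s A B).symm

theorem lamTerm_code {X : C} {A : LUType X} {B : LUType (pullback A.r A.p)}
    (b : LUTerm (pullback A.r A.p)) (hb : b.toLUType = B) :
    lamTerm S (classifies_code hK A b.toLUType) b rfl =
      lamTerm S (classifies_code hK A B) b hb := by
  subst hb
  rfl

/-- The Π-types of a local universes construction in which families of types have universal
codes. -/
noncomputable def piStructure (X : C) : ((localUniverses C).conCat X).PiStructure where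
  Pi A B := piType S (code hK A B)
  lam A b := lamTerm S (classifies_code hK A b.toLUType) b rfl
  app A B f a hf ha := appTerm S (classifies_code hK A B) f a hf ha
  tp_lam _ _ := rfl
  tp_app _ _ _ _ _ _ := rfl
  Pi_sub s A B := (piType_code_sub hK S s.map A B).symm
  lam_sub s A _ := tmSub_lamTerm S _ s.map _ rfl rfl (piType_code_sub hK S s.map A _) _ _ _ _ rfl
  app_sub s A B _ _ _ _ := tmSub_appTerm S _ s.map _ rfl rfl (piType_code_sub hK S s.map A B)
    _ _ _ _ _ _ _ _ rfl rfl
  beta _ b a ha := beta_appTerm S _ b rfl a _ ha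
  eta A B f hf := (lamTerm_code hK S _ ((localUniverses C).tySub_inst_var_lift A B)).trans
    (eta_lamTerm S (classifies_code hK A B) f hf (classifies_code hK _ _) rfl rfl
      (piType_code_sub hK S _ A B) _ _ rfl _ _)

theorem preservesPi_reindex {X Y : C} (s : Y ⟶ X) :
    ((localUniverses C).reindex s).PreservesPi (piStructure hK S X) (piStructure hK S Y) := by
  have e : ∀ {Γ : (localUniverses C).CtxOver X} (A : LUType Γ.obj) (B : LUType (pullback A.r A.p)),
      ((localUniverses C).reindex s).onTyExt A B =
      (localUniverses C).tySub ((localUniverses C).lift ((localUniverses C).reindexMap s Γ) A _ rfl)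
        B := fun A B => (localUniverses C).tySub_id _
  have e' : ∀ {Γ : (localUniverses C).CtxOver X} (A : LUType Γ.obj) (b : LUTerm (pullback A.r A.p)),
      ((localUniverses C).reindex s).onTmExt A b =
      (localUniverses C).tmSub ((localUniverses C).lift ((localUniverses C).reindexMap s Γ) A _ rfl)
        b := fun A B => (localUniverses C).tmSub_id _
  have h : ∀ {Γ : (localUniverses C).CtxOver X} (A : LUType Γ.obj) (B : LUType (pullback A.r A.p))
      (B' : LUType _), B' =
        (localUniverses C).tySub ((localUniverses C).lift ((localUniverses C).reindexMap s Γ) A _ rfl)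
        B → piType S (code hK ((localUniverses C).tySub ((localUniverses C).reindexMap s Γ) A) B') =
        (localUniverses C).tySub ((localUniverses C).reindexMap s Γ) (piType S (code hK A B)) := by
    rintro Γ A B _ rfl
    exact piType_code_sub hK S _ A B
  refine ⟨?_, ?_, ?_⟩
  · intro Γ A B
    exact (h A B _ (e A B)).symm
  · intro Γ A b
    exact tmSub_lamTerm S _ _ _ rfl (congrArg LUTerm.toLUType (e' A b))
      (h A _ _ (congrArg LUTerm.toLUType (e' A b))) _ _ _ _ (e' A b)
  · intro Γ A B f a hf ha
    exact tmSub_appTerm S (classifies_code hK A B) _ (classifies_code hK _ _) rfl (e A B)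
      (h A B _ (e A B)) _ _ _ _ _ _ _ _ rfl rfl

end PiTypes

section EmptyPiTypes

theorem Classifies.restrict {K : ∀ U W : LocalUniverse C, FamilyObject U W}
    {V' : ∀ _ _ : LocalUniverse C, C} (ε : ∀ U W, V' U W ⟶ (K U W).V) {X : C} {A : LUType X}
    {B : LUType (pullback A.r A.p)} {r : X ⟶ (K A.toLocalUniverse B.toLocalUniverse).V}
    (hr : Classifies K A B r) (r' : X ⟶ V' A.toLocalUniverse B.toLocalUniverse)
    (h : r' ≫ ε _ _ = r) :
    Classifies (fun U W => (K U W).restrict (ε U W)) A B r' := by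
  subst h
  exact ⟨(Category.assoc _ _ _).symm.trans hr.base,
    ((K _ _).fam_congr (Category.assoc _ _ _) rfl _).trans hr.fam⟩

variable {K : ∀ U W : LocalUniverse C, FamilyObject U W}
  (S : ∀ U W : LocalUniverse C, SectionUniverse (K U W))

variable {X : C}
  (c : ∀ (A : LUType X) (B : LUType (pullback A.r A.p)),
    X ⟶ (K A.toLocalUniverse B.toLocalUniverse).V)
  (hc : ∀ A B, Classifies K A B (c A B))

include hc in
theorem classifies_wk (A : LUType X) (B : LUType (pullback A.r A.p))
    (Δ : (localUniverses C).CtxOver X) :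
    Classifies K (((localUniverses C).conCat X).wk A Δ)
      (((localUniverses C).conCat X).wkUnder A B Δ) (Δ.tel.root ≫ c A B) :=
  (hc A B).sub Δ.tel.root

/-- The Π-types in the empty context of a local universes construction over `X` in which families
of types over `X` have chosen codes. -/
noncomputable def emptyPiStructure : ((localUniverses C).conCat X).EmptyPiStructure where
  Pi A B := piType S (c A B)
  lam A B Δ b hb := lamTerm S (classifies_wk c hc A B Δ) b hb
  app A B Δ f a hf ha := appTerm S (classifies_wk c hc A B Δ) f a hf ha
  tp_lam _ _ _ _ _ := rfl
  tp_app _ _ _ _ _ _ _ := rfl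
  lam_sub A B _ _ s _ _ := tmSub_lamTerm S _ s.map _
    (((localUniverses C).conCat X).wk_sub A s) (((localUniverses C).conCat X).wkUnder_sub A B s).symm
    (((localUniverses C).conCat X).wk_sub (piType S (c A B)) s) _ _ _ _ rfl
  app_sub A B _ _ s _ _ _ _ := tmSub_appTerm S _ s.map _
    (((localUniverses C).conCat X).wk_sub A s) (((localUniverses C).conCat X).wkUnder_sub A B s).symm
    (((localUniverses C).conCat X).wk_sub (piType S (c A B)) s) _ _ _ _ _ _ _ _ rfl rfl
  beta _ _ _ b hb a ha := beta_appTerm S _ b hb a _ ha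
  eta A B Δ f hf := eta_lamTerm S (classifies_wk c hc A B Δ) f hf (classifies_wk c hc A B _)
    (((localUniverses C).conCat X).wk_sub A (((localUniverses C).conCat X).cwf.proj _))
    (((localUniverses C).conCat X).wkUnder_sub A B (((localUniverses C).conCat X).cwf.proj _)).symm
    (((localUniverses C).conCat X).wk_sub (piType S (c A B))
      (((localUniverses C).conCat X).cwf.proj _)) _ _ rfl _ _

theorem preservesEmptyPi_reindex {Y : C} (s : Y ⟶ X)
    (d : ∀ (A : LUType Y) (B : LUType (pullback A.r A.p)),
      Y ⟶ (K A.toLocalUniverse B.toLocalUniverse).V)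
    (hd : ∀ A B, Classifies K A B (d A B))
    (hcd : ∀ A B, d ((localUniverses C).tySub s A)
      ((localUniverses C).tySub ((localUniverses C).lift s A _ rfl) B) = s ≫ c A B) :
    ((localUniverses C).reindex s).PreservesEmptyPi (emptyPiStructure S c hc)
      (emptyPiStructure S d hd) := by
  have key : ∀ (A : LUType X) (B : LUType (pullback A.r A.p)) (A' : LUType Y)
      (hA : A' = (localUniverses C).tySub s A) (B' : LUType (pullback A'.r A'.p))
      (_ : B' = (localUniverses C).tySub ((localUniverses C).lift s A A' hA) B),
      piType S (d A' B') = (localUniverses C).tySub s (piType S (c A B)) := by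
    rintro A B _ rfl _ rfl
    exact congrArg (LUType.mk _) (hcd A B)
  have hPi : ∀ (A : LUType X) (B : LUType (pullback A.r A.p)),
      ((localUniverses C).reindex s).onTyEmpty (piType S (c A B)) =
        piType S (d (((localUniverses C).reindex s).onTyEmpty A)
          (((localUniverses C).reindex s).onTyExtEmpty A B)) := by
    intro A B
    have hA : ((localUniverses C).reindex s).onTyEmpty A = (localUniverses C).tySub s A :=
      (localUniverses C).tySub_id _
    refine ((localUniverses C).tySub_id _).trans (key A B _ hA _ ?_).symm
    rw [(localUniverses C).lift_eq_eqToHom (Γ := ⟨Y, Tel.nil⟩) s A _ hA (by rw [hA])]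
    exact ((localUniverses C).tySub_comp _ _ _).symm
  have hU : ∀ (A : LUType X) (B : LUType (pullback A.r A.p)) (Δ : (localUniverses C).CtxOver X),
      ((localUniverses C).conCat Y).wkUnder (((localUniverses C).reindex s).onTyEmpty A)
        (((localUniverses C).reindex s).onTyExtEmpty A B) ((localUniverses C).reindexObj s Δ) =
      (localUniverses C).tySub ((localUniverses C).lift ((localUniverses C).reindexMap s Δ)
        (((localUniverses C).conCat X).wk A Δ) _
        (((localUniverses C).reindex s).onTy_wk A Δ).symm)
        (((localUniverses C).conCat X).wkUnder A B Δ) := by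
    intro A B Δ
    refine (((localUniverses C).reindex s).onTy_wkUnder A B Δ).symm.trans ?_
    rw [(localUniverses C).lift_eq_eqToHom (Γ := (localUniverses C).reindexObj s Δ) _ _ _
      (((localUniverses C).reindex s).onTy_wk A Δ).symm
      (((localUniverses C).reindex s).obj_ext_wk A Δ).symm]
    exact ((localUniverses C).tySub_comp _ _ _).symm
  have hP : ∀ (A : LUType X) (B : LUType (pullback A.r A.p)) (Δ : (localUniverses C).CtxOver X),
      ((localUniverses C).conCat Y).wk (piType S (d (((localUniverses C).reindex s).onTyEmpty A)
          (((localUniverses C).reindex s).onTyExtEmpty A B))) ((localUniverses C).reindexObj s Δ) =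
      (localUniverses C).tySub ((localUniverses C).reindexMap s Δ)
        (((localUniverses C).conCat X).wk (piType S (c A B)) Δ) := by
    intro A B Δ
    refine (congrArg (fun T => ((localUniverses C).conCat Y).wk T _) (hPi A B).symm).trans ?_
    exact (((localUniverses C).reindex s).onTy_wk (piType S (c A B)) Δ).symm
  refine ⟨hPi, ?_, ?_⟩
  · intro A B Δ b hb
    refine tmSub_lamTerm S _ _ _ (((localUniverses C).reindex s).onTy_wk A Δ).symm (hU A B Δ)
      (hP A B Δ) _ _ _ _ ?_
    have e := (localUniverses C).lift_eq_eqToHom (Γ := (localUniverses C).reindexObj s Δ) _ _ _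
      (((localUniverses C).reindex s).onTy_wk A Δ).symm
      (((localUniverses C).reindex s).obj_ext_wk A Δ).symm
    exact ((localUniverses C).tmSub_comp _ _ _).symm.trans
      (congrArg (fun m => (localUniverses C).tmSub m b) e.symm)
  · intro A B Δ f a hf ha
    exact tmSub_appTerm S (classifies_wk c hc A B Δ) _ (classifies_wk d hd _ _ _)
      (((localUniverses C).reindex s).onTy_wk A Δ).symm (hU A B Δ) (hP A B Δ) _ _ _ _ _ _ _ _ rfl rfl

end EmptyPiTypes

end CategoryWithFibrations

theorem CategoryWithFibrations.fib_root {C : Type u} [Category.{v} C] [CategoryWithFibrations C]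
    (h : (fib : MorphismProperty C).IsMultiplicative) {X Y : C} (T : Tel (localUniverses C) X Y) :
    fib T.root := by
  induction T with
  | nil => exact h.id_mem X
  | snoc T A ih =>
    have := A.hasPullback
    exact h.comp_mem _ _ (MorphismProperty.of_isPullback
      (IsPullback.of_hasPullback A.r A.p).flip A.fib_p) ih

theorem CategoryWithFibrations.isFibrant_obj {C : Type u} [Category.{v} C]
    [CategoryWithFibrations C] (h : (fib : MorphismProperty C).IsMultiplicative)
    (Γ : (shriek C).Ctx) : IsFibrant ((shriekFunctor C).obj Γ) := by
  have e : (CwF.CtxOver.tel Γ).root = terminal.from ((shriekFunctor C).obj Γ) :=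
    terminal.hom_ext _ _
  exact (congrArg (fun m => fib m) e).mp (fib_root h _)

end IndexedTT

theorem mainTheorem12
    {B : Type u₁} [Category.{v₁} B] [CategoryWithFibrations B]
    {C : Type u₂} [Category.{v₂} C] [CategoryWithFibrations C] [HasBinaryProducts C]
    (F : B ⥤ C)
    (Pf : ∀ {X Y : C} (f : X ⟶ Y), fib f → (Over X ⥤ Over Y))
    (adj : ∀ {X Y : C} (f : X ⟶ Y) (hf : fib f), pullbackFunctor f hf ⊣ Pf f hf) :
    ((∀ {X Y : C} (f : X ⟶ Y) (hf : fib f), PreservesFibrations (Pf f hf)) →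
      (pullbackShriek F).HasPiTypes) ∧
    ((fib : MorphismProperty B).IsMultiplicative →
      ∀ C' : ObjectProperty C,
        (∀ {X Y : C} (f : X ⟶ Y) (hf : fib f), C' Y → PreservesFibrations (Pf f hf)) →
        (∀ X : C, ∃ (X' : C) (ε : X' ⟶ X), C' X' ∧
          ∃ fac : ∀ Γ : B, IsFibrant Γ → (F.obj Γ ⟶ X) → (F.obj Γ ⟶ X'),
            (∀ (Γ : B) (hΓ : IsFibrant Γ) (h : F.obj Γ ⟶ X), fac Γ hΓ h ≫ ε = h) ∧
            (∀ (Γ Δ : B) (hΓ : IsFibrant Γ) (hΔ : IsFibrant Δ) (s : Γ ⟶ Δ) (h : F.obj Δ ⟶ X),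
              fac Γ hΓ (F.map s ≫ h) = F.map s ≫ fac Δ hΔ h)) →
        (pullbackShriek F).IsCartesianClosed) := by
  let K : ∀ U W : LocalUniverse C, FamilyObject U W := fun U W =>
    FamilyObject.ofAdjunction (adj U.p U.fib_p)
  have hK : ∀ U W, (K U W).IsUniversal := fun U W =>
    FamilyObject.isUniversal_ofAdjunction (adj U.p U.fib_p)
  constructor
  · intro hPf
    let S : ∀ U W, SectionUniverse (K U W) := fun U W =>
      (SectionUniverse.nonempty_of_adjunction (K U W) Pf adj hPf).some
    exact ⟨fun Γ => piStructure hK S (F.obj ((shriekFunctor B).obj Γ.unop)),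
      fun s => preservesPi_reindex hK S (F.map ((shriekFunctor B).map s.unop))⟩
  · intro hB C' hPf hC'
    choose V' ε hV' fac hfac hnat using hC'
    let K' : ∀ U W : LocalUniverse C, FamilyObject U W := fun U W =>
      (K U W).restrict (ε (K U W).V)
    let S : ∀ U W, SectionUniverse (K' U W) := fun U W =>
      (SectionUniverse.nonempty_of_adjunction (K' U W) Pf adj
        (fun f hf => hPf f hf (hV' _))).some
    have hfib : ∀ Γ : (shriek B).Ctx, IsFibrant ((shriekFunctor B).obj Γ) := isFibrant_obj hB
    refine ⟨fun Γ => emptyPiStructure S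
      (fun A A' => fac _ _ (hfib Γ.unop) (code hK A A'))
      (fun A A' => (classifies_code hK A A').restrict _ _ (hfac _ _ _ _)), fun {Γ Δ} s =>
      preservesEmptyPi_reindex S _ _ (F.map ((shriekFunctor B).map s.unop)) _ _ ?_⟩
    intro A A'
    refine Eq.trans ?_ (hnat _ _ _ (hfib _) (hfib _) ((shriekFunctor B).map s.unop) _)
    exact congrArg (fac _ _ _) (comp_code hK (F.map ((shriekFunctor B).map s.unop)) A A').symm
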